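/- Let $K$ be a commutative ring, $\mathbf H$ a Hopf $K$-algebra, $A$ a right $\mathbf H$-comodule $K$-algebra (a $K$-algebra with a coassociative, counital coaction $\rho_A\colon A\to A\otimes_K\mathbf H$, $a\mapsto\sum a_{(0)}\otimes a_{(1)}$, that is a $K$-algebra map), and $C$ a left $\mathbf H$-module $K$-coalgebra (a $K$-coalgebra and left $\mathbf H$-module whose action $\mathbf H\otimes_K C\to C$ is a $K$-coalgebra map). Let $C^*=\mathrm{Hom}_K(C,K)$ be the convolution algebra, $(xy)(c)=\sum x(c_{(1)})y(c_{(2)})$, with the right $\mathbf H$-action $(xh)(c)=x(hc)$. The smash product $A\sharp C^*$ is the $K$-module $A\otimes_K C^*$ with the multiplication $$(a\sharp x)(b\sharp y)=\sum ab_{(0)}\sharp(xb_{(1)})y$$ and unit $1\sharp\varepsilon_C$. Left $A\sharp C^*$-modules are regarded as left $A$-modules and left $C^*$-modules along $a\mapsto a\sharp\varepsilon_C$ and $x\mapsto 1\sharp x$. Put $B=(A\sharp C^*)^{o}$, so that right $B$-modules are left $A\sharp C^*$-modules. For a left $C^*$-module $M$ let $\mathrm{Rat}_C(M)$ be the $C^*$-submodule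 of all $m\in M$ for which there are finitely many $(c_i,m_i)\in C\times M$ with $xm=\sum_i x(c_i)m_i$ for all $x\in C^*$. Let $\mathfrak a=\mathrm{Rat}^{\mathcal T}(B_B)$ be the rational part of $B_B$ for the pairing $\mathcal T$ between $A^{o}\otimes_K C$ and $B$ with values in $A^{o}$ given by $\langle a^o\otimes c,(b\sharp x)^o\rangle=a^ob^ox(c)$; that is, $\mathfrak a$ consists of all $u\in B$ for which there are finitely many $(z_i,u_i)\in(A^o\otimes_K C)\times B$ with $ub=\sum_i u_i\langle z_i,b\rangle$ (products in $B$) for all $b\in B$. A Doi-Koppinen module is a left $A$-module $M$ with a right $C$-comodule structure $\rho_M\colon M\to M\otimes_KC$, $m\mapsto\sum m_{(0)}\otimes m_{(1)}$, such that $\rho_M(am)=\sum a_{(0)}m_{(0)}\otimes a_{(1)}m_{(1)}$; morphisms are the left $A$-linear, right $C$-colinear maps. Every Doi-Koppinen module is a left $A\sharp C^*$-module by $(a\sharp x)m=\sum a\,m_{(0)}x(m_{(1)})$. Assume that $C$ is locally projective over $K$ (for every surjection of $K$-modules $g\colon L\to N$, every $K$-linear $f\colon C\to N$ and every finitely generated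 submodule $F\subseteq C$ there is a $K$-linear $h\colon C\to L$ with $g\circ h=f$ on $F$), that $A$ is flat over $K$, and that the functor $\mathrm{Rat}_C$ on left $C^*$-modules is exact. For a left $A\sharp C^*$-module $M$, $\mathrm{Rat}_C(M)$ is an $A\sharp C^*$-submodule of $M$ and a Doi-Koppinen module whose coaction sends $m$ to the unique $\sum_i m_i\otimes c_i\in\mathrm{Rat}_C(M)\otimes_K C$ with $xm=\sum_i x(c_i)m_i$ for all $x\in C^*$; this gives a functor $\mathrm{Rat}_C$ from left $A\sharp C^*$-modules to Doi-Koppinen modules. Then: (a) $\mathrm{Rat}_C(C^*)$ is a right $\mathbf H$-submodule of $C^*$, and $\mathfrak a=A\otimes_K\mathrm{Rat}_C(C^*)$; that is, the canonical map $A\otimes_K\mathrm{Rat}_C(C^*)\to A\otimes_K C^*=A\sharp C^*$ is injective with image $\mathfrak a$. (b) For each right $B$-module $M$ the map $$\mathrm{Hom}_B(\mathfrak a_B,M)\to\mathrm{Hom}_{C^*}(\mathrm{Rat}_C(C^*),M),\qquad f\mapsto\widehat f,\quad \widehat f(y)=f(1\otimes y),$$ is an isomorphism of $K$-modules. (c)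 For every left $A\sharp C^*$-module $M$, endow $\mathrm{Hom}_{C^*}(\mathrm{Rat}_C(C^*),M)$ with the left $A\sharp C^*$-module structure transferred along the isomorphism of (b) from $\mathrm{Hom}_{A\sharp C^*}(\mathfrak a,M)$, on which $A\sharp C^*$ acts by $(sf)(u)=f(us)$ (product in $A\sharp C^*$). Then $\mathrm{Hom}_{C^*}(\mathrm{Rat}_C(C^*),-)$ (with composition on morphisms) is a functor from Doi-Koppinen modules to left $A\sharp C^*$-modules, and it is right adjoint to the functor $\mathrm{Rat}_C$ from left $A\sharp C^*$-modules to Doi-Koppinen modules. -/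

import Mathlib

open CategoryTheory
open scoped TensorProduct

universe u

set_option linter.unusedSectionVars false

noncomputable section

namespace DoiKoppinen

/-- The convolution algebra `C* = Hom_K(C, K)`, with `(x y)(c) = ∑ x(c₁) y(c₂)` and unit `ε`. -/
abbrev Dual (K C : Type u) [CommRing K] [AddCommGroup C] [Module K C] [Coalgebra K C] : Type u :=
  WithConv (C →ₗ[K] K)

/-- A right `H`-comodule algebra structure on the `K`-algebra `A`: a right `H`-coaction
`ρ(a) = ∑ a₀ ⊗ a₁` that is a homomorphism of `K`-algebras. -/
class RightComoduleAlgebra (K H A : Type u) [CommRing K] [Ring H] [Bialgebra K H]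
    [Ring A] [Algebra K A] where
  coact : A →ₐ[K] A ⊗[K] H
  coassoc : ∀ a : A, TensorProduct.assoc K A H H (coact.toLinearMap.rTensor H (coact a)) =
    (Coalgebra.comul (R := K) (A := H)).lTensor A (coact a)
  counit_coact : ∀ a : A, TensorProduct.rid K A
    ((Coalgebra.counit (R := K) (A := H)).lTensor A (coact a)) = a

/-- The action of a `K`-algebra `R` on an `R`-module `M` as a `K`-bilinear map. -/
def act (K R M : Type u) [CommRing K] [Ring R] [Algebra K R] [AddCommGroup M] [Module K M]
    [Module R M] [IsScalarTower K R M] : R →ₗ[K] M →ₗ[K] M :=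
  (Algebra.lsmul K K M).toLinearMap

/-- A left `H`-module coalgebra: a left `H`-module `C` for which the action `H ⊗ C → C` is a
homomorphism of `K`-coalgebras, `Δ(h c) = ∑ h₁ c₁ ⊗ h₂ c₂` and `ε(h c) = ε(h) ε(c)`. -/
class LeftModuleCoalgebra (K H C : Type u) [CommRing K] [Ring H] [Bialgebra K H]
    [AddCommGroup C] [Module K C] [Coalgebra K C] [Module H C] [IsScalarTower K H C] : Prop where
  comul_smul : ∀ (h : H) (c : C), Coalgebra.comul (R := K) (h • c) =
    TensorProduct.map₂ (act K H C) (act K H C) (Coalgebra.comul (R := K) h)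
      (Coalgebra.comul (R := K) c)
  counit_smul : ∀ (h : H) (c : C), Coalgebra.counit (R := K) (h • c) =
    Coalgebra.counit (R := K) h * Coalgebra.counit (R := K) c

/-- Local projectivity of a module: maps to the target of a surjection can be lifted on every
finitely generated submodule. -/
def LocallyProjective (K C : Type u) [CommRing K] [AddCommGroup C] [Module K C] : Prop :=
  ∀ F : Submodule K C, F.FG → ∀ (L N : Type u) [AddCommGroup L] [AddCommGroup N] [Module K L]
    [Module K N] (g : L →ₗ[K] N) (f : C →ₗ[K] N), Function.Surjective g →
    ∃ h : C →ₗ[K] L, ∀ c ∈ F, g (h c) = f c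

section Eval

variable {K C M : Type u} [CommRing K] [AddCommGroup C] [Module K C] [Coalgebra K C]
  [AddCommGroup M] [Module K M]

/-- The contraction `M ⊗ C → M`, `m ⊗ c ↦ x(c) m`. -/
def contract (M : Type u) [AddCommGroup M] [Module K M] (x : Dual K C) : M ⊗[K] C →ₗ[K] M :=
  (TensorProduct.rid K M).toLinearMap ∘ₗ x.ofConv.lTensor M

@[simp] theorem contract_tmul (x : Dual K C) (m : M) (c : C) :
    contract M x (m ⊗ₜ[K] c) = x c • m := by
  simp [contract]

theorem contract_add (x y : Dual K C) : contract M (x + y) = contract M x + contract M y := by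
  ext m c; simp [add_smul]

theorem contract_smul (k : K) (x : Dual K C) : contract M (k • x) = k • contract M x := by
  ext m c; simp [mul_smul]

theorem contract_one (t : M ⊗[K] C) : contract M (1 : Dual K C) t =
    TensorProduct.rid K M ((Coalgebra.counit (R := K) (A := C)).lTensor M t) := by
  induction t with
  | zero => simp
  | tmul m c => simp
  | add s t hs ht => simp [hs, ht]

theorem contract_map {M' : Type u} [AddCommGroup M'] [Module K M'] (f : M →ₗ[K] M')
    (x : Dual K C) (t : M ⊗[K] C) : contract M' x (f.rTensor C t) = f (contract M x t) := by
  induction t with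
  | zero => simp
  | tmul m c => simp
  | add s t hs ht => simp [hs, ht]

theorem contract_mul (x y : Dual K C) (t : M ⊗[K] C) : contract M (x * y) t =
    contract M x (contract (M ⊗[K] C) y ((TensorProduct.assoc K M C C).symm
      ((Coalgebra.comul (R := K) (A := C)).lTensor M t))) := by
  induction t with
  | zero => simp
  | add s t hs ht => simp [hs, ht]
  | tmul m c =>
    simp only [contract_tmul, LinearMap.lTensor_tmul, LinearMap.convMul_apply]
    generalize Coalgebra.comul (R := K) c = d
    induction d with
    | zero => simp
    | add s t hs ht => simp [hs, ht, add_smul, TensorProduct.tmul_add]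
    | tmul c d => simp [mul_smul, smul_comm (x.ofConv c)]

theorem exists_fg_fixed (t : M ⊗[K] C) : ∃ F : Submodule K C, F.FG ∧
    ∀ p : C →ₗ[K] C, (∀ c ∈ F, p c = c) → p.lTensor M t = t := by
  induction t with
  | zero => exact ⟨⊥, Submodule.fg_bot, by simp⟩
  | tmul m c =>
    refine ⟨Submodule.span K {c}, Submodule.fg_span_singleton c, fun p hp => ?_⟩
    simp [hp c (Submodule.mem_span_singleton_self c)]
  | add s t hs ht =>
    obtain ⟨F, hF, h1⟩ := hs
    obtain ⟨G, hG, h2⟩ := ht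
    refine ⟨F ⊔ G, hF.sup hG, fun p hp => ?_⟩
    rw [map_add, h1 p fun c hc => hp c (Submodule.mem_sup_left hc),
      h2 p fun c hc => hp c (Submodule.mem_sup_right hc)]

theorem LocallyProjective.exists_lift (hC : LocallyProjective K C) (F : Submodule K C)
    (hF : F.FG) : ∃ h : C →ₗ[K] C →₀ K,
      ∀ c ∈ F, Finsupp.linearCombination K (id : C → C) (h c) = c :=
  hC F hF (C →₀ K) C (Finsupp.linearCombination K id) LinearMap.id
    (Finsupp.linearCombination_id_surjective K C)

/-- Over a locally projective coalgebra the elements of `M ⊗ C` are separated by `C*`. -/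
theorem LocallyProjective.eq_zero (hC : LocallyProjective K C) (t : M ⊗[K] C)
    (ht : ∀ x : Dual K C, contract M x t = 0) : t = 0 := by
  classical
  obtain ⟨F, hF, hfix⟩ := exists_fg_fixed t
  obtain ⟨h, hh⟩ := hC.exists_lift F hF
  have h0 : h.lTensor M t = 0 := by
    apply (TensorProduct.finsuppScalarRight K K M C).injective
    rw [map_zero]
    ext c
    have key : ∀ s : M ⊗[K] C, TensorProduct.finsuppScalarRight K K M C (h.lTensor M s) c =
        contract M (WithConv.toConv (Finsupp.lapply c ∘ₗ h)) s := by
      intro s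
      induction s with
      | zero => simp
      | tmul m d => simp
      | add s t hs ht => simp [hs, ht]
    rw [key, ht]; rfl
  have h1 := hfix (Finsupp.linearCombination K id ∘ₗ h) hh
  rw [LinearMap.lTensor_comp, LinearMap.comp_apply, h0, map_zero] at h1
  exact h1.symm

theorem LocallyProjective.ext (hC : LocallyProjective K C) {s t : M ⊗[K] C}
    (h : ∀ x : Dual K C, contract M x s = contract M x t) : s = t :=
  sub_eq_zero.mp (hC.eq_zero _ fun x => by rw [map_sub, h, sub_self])

end Eval

section Rational

variable (K C : Type u) [CommRing K] [AddCommGroup C] [Module K C] [Coalgebra K C]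

/-- An element `m` of a left `C*`-module is rational if there are finitely many
`(cᵢ, mᵢ) ∈ C × M` with `x m = ∑ x(cᵢ) mᵢ` for all `x ∈ C*`. -/
def IsRational {M : Type u} [AddCommGroup M] [Module K M] [Module (Dual K C) M] (m : M) : Prop :=
  ∃ (n : ℕ) (c : Fin n → C) (m' : Fin n → M), ∀ x : Dual K C, x • m = ∑ i, x (c i) • m' i

variable {K C} in
theorem isRational_iff {M : Type u} [AddCommGroup M] [Module K M] [Module (Dual K C) M] (m : M) :
    IsRational K C m ↔ ∃ t : M ⊗[K] C, ∀ x : Dual K C, x • m = contract M x t := by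
  constructor
  · rintro ⟨n, c, m', h⟩
    exact ⟨∑ i, m' i ⊗ₜ c i, fun x => by simp [h]⟩
  · rintro ⟨t, h⟩
    have : ∃ (n : ℕ) (c : Fin n → C) (m' : Fin n → M), t = ∑ i, m' i ⊗ₜ c i := by
      clear h
      induction t with
      | zero => exact ⟨0, Fin.elim0, Fin.elim0, by simp⟩
      | tmul m c => exact ⟨1, fun _ => c, fun _ => m, by simp⟩
      | add s t hs ht =>
        obtain ⟨n, c, m', rfl⟩ := hs
        obtain ⟨k, d, n', rfl⟩ := ht
        refine ⟨n + k, Fin.append c d, Fin.append m' n', ?_⟩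
        simp [Fin.sum_univ_add]
    obtain ⟨n, c, m', rfl⟩ := this
    exact ⟨n, c, m', fun x => by simp [h]⟩

/-- `Rat_C(M)`, the `C*`-submodule of rational elements of a left `C*`-module `M`. -/
def ratC (M : Type u) [AddCommGroup M] [Module K M] [Module (Dual K C) M]
    [IsScalarTower K (Dual K C) M] : Submodule (Dual K C) M where
  carrier := {m | IsRational K C m}
  add_mem' {a b} ha hb := by
    obtain ⟨s, hs⟩ := (isRational_iff a).1 ha
    obtain ⟨t, ht⟩ := (isRational_iff b).1 hb
    exact (isRational_iff _).2 ⟨s + t, fun x => by rw [smul_add, hs, ht, map_add]⟩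
  zero_mem' := (isRational_iff _).2 ⟨0, by simp⟩
  smul_mem' y m hm := by
    obtain ⟨t, ht⟩ := (isRational_iff m).1 hm
    refine (isRational_iff _).2 ⟨contract (M ⊗[K] C) y ((TensorProduct.assoc K M C C).symm
      ((Coalgebra.comul (R := K) (A := C)).lTensor M t)), fun x => ?_⟩
    rw [smul_smul, ht, contract_mul]

variable {K C} in
theorem mem_ratC {M : Type u} [AddCommGroup M] [Module K M] [Module (Dual K C) M]
    [IsScalarTower K (Dual K C) M] {m : M} : m ∈ ratC K C M ↔ IsRational K C m := Iff.rfl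

variable {K C} in
theorem ratC_map {M M' : Type u} [AddCommGroup M] [Module K M] [Module (Dual K C) M]
    [IsScalarTower K (Dual K C) M] [AddCommGroup M'] [Module K M'] [Module (Dual K C) M']
    [IsScalarTower K (Dual K C) M'] (f : M →ₗ[Dual K C] M') {m : M} (hm : m ∈ ratC K C M) :
    f m ∈ ratC K C M' := by
  obtain ⟨n, c, m', h⟩ := hm
  refine ⟨n, c, fun i => f (m' i), fun x => ?_⟩
  rw [← map_smul, h, map_sum]
  refine Finset.sum_congr rfl fun i _ => ?_
  rw [← algebraMap_smul (Dual K C) (x (c i)) (m' i), map_smul, algebraMap_smul]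

/-- Modules over a `K`-algebra are regarded as `K`-modules. -/
instance dualModuleCatBase (M : ModuleCat.{u} (Dual K C)) : Module K M :=
  Module.restrictScalars K (Dual K C) M

instance dualModuleCatTower (M : ModuleCat.{u} (Dual K C)) : IsScalarTower K (Dual K C) M :=
  IsScalarTower.restrictScalars K (Dual K C) M

/-- The rational functor `Rat_C` on left `C*`-modules. -/
def ratFunctor : ModuleCat.{u} (Dual K C) ⥤ ModuleCat.{u} (Dual K C) where
  obj M := ModuleCat.of (Dual K C) (ratC K C M)
  map f := ModuleCat.ofHom (f.hom.restrict fun _ hm => ratC_map f.hom hm)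

instance : (ratFunctor K C).PreservesZeroMorphisms where
  map_zero _ _ := rfl

/-- Exactness of `Rat_C`: short exact sequences are sent to short exact sequences. -/
def RatExact : Prop :=
  ∀ E : ShortComplex (ModuleCat.{u} (Dual K C)), E.ShortExact →
    (E.map (ratFunctor K C)).ShortExact

end Rational

section SmashProduct

variable (K H A C : Type u) [CommRing K] [Ring H] [HopfAlgebra K H] [Ring A] [Algebra K A]
  [AddCommGroup C] [Module K C] [Coalgebra K C] [Module H C]
  [IsScalarTower K H C]

variable {K H C} in
/-- The right action of `H` on `C*`, `(x h)(c) = x(h c)`. -/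
def dualAct : Dual K C →ₗ[K] H →ₗ[K] Dual K C :=
  LinearMap.mk₂ K (fun x h => WithConv.toConv (x.ofConv ∘ₗ act K H C h))
    (fun _ _ _ => rfl) (fun _ _ _ => rfl)
    (fun x h k => by ext c; simp)
    (fun k x h => by ext c; simp)

variable {K H C} in
@[simp] theorem dualAct_apply (x : Dual K C) (h : H) (c : C) : dualAct x h c = x (h • c) := rfl

variable {K H C} in
theorem dualAct_one (x : Dual K C) : dualAct x (1 : H) = x := by
  ext c; simp

variable {K H C} in
theorem dualAct_mul (x : Dual K C) (h k : H) : dualAct x (h * k) = dualAct (dualAct x h) k := by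
  ext c; simp [mul_smul]

variable {K H C} in
theorem one_dualAct [LeftModuleCoalgebra K H C] (h : H) :
    dualAct (1 : Dual K C) h = Coalgebra.counit (R := K) h • (1 : Dual K C) := by
  ext c
  simp [LeftModuleCoalgebra.counit_smul]

variable {K H C} in
/-- The bilinear map `h ⊗ k ↦ (x h)(y k)`. -/
def dualActMul (x y : Dual K C) : H ⊗[K] H →ₗ[K] Dual K C :=
  TensorProduct.lift ((LinearMap.mul K (Dual K C)).compl₁₂ (dualAct x) (dualAct y))

variable {K H C} in
theorem mul_dualAct [LeftModuleCoalgebra K H C] (x y : Dual K C) (h : H) :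
    dualAct (x * y) h = dualActMul x y (Coalgebra.comul (R := K) h) := by
  ext c
  simp only [dualAct_apply, LinearMap.convMul_apply, LeftModuleCoalgebra.comul_smul]
  generalize Coalgebra.comul (R := K) h = t
  induction t with
  | zero => simp
  | add s t hs ht => simp [hs, ht]
  | tmul h k =>
    simp only [dualActMul, TensorProduct.lift.tmul, LinearMap.compl₁₂_apply,
      LinearMap.mul_apply', LinearMap.convMul_apply]
    generalize Coalgebra.comul (R := K) c = d
    induction d with
    | zero => simp
    | add s t hs ht => simp only [map_add, hs, ht]
    | tmul c d => simp [act]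

/-- The smash product `A ♯ C*`: the `K`-module `A ⊗ C*` with the multiplication below. -/
def Smash (_K _H _A _C : Type u) [CommRing _K] [Ring _H] [HopfAlgebra _K _H] [Ring _A]
    [Algebra _K _A] [AddCommGroup _C] [Module _K _C] [Coalgebra _K _C] [Module _H _C]
    [IsScalarTower _K _H _C] : Type u :=
  _A ⊗[_K] Dual _K _C

instance : AddCommGroup (Smash K H A C) := inferInstanceAs (AddCommGroup (A ⊗[K] Dual K C))

instance : Module K (Smash K H A C) := inferInstanceAs (Module K (A ⊗[K] Dual K C))

namespace Smash

/-- The identity `A ⊗ C* = A ♯ C*` of `K`-modules. -/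
def equiv : A ⊗[K] Dual K C ≃ₗ[K] Smash K H A C := LinearEquiv.refl K (A ⊗[K] Dual K C)

variable {A C} in
/-- The element `a ♯ x`. -/
def mk (a : A) (x : Dual K C) : Smash K H A C := equiv K H A C (a ⊗ₜ[K] x)

variable {K H A C}

@[elab_as_elim]
theorem induction_on {P : Smash K H A C → Prop} (s : Smash K H A C) (zero : P 0)
    (mk : ∀ a x, P (mk K H a x)) (add : ∀ s t, P s → P t → P (s + t)) : P s :=
  TensorProduct.induction_on (motive := P) s zero mk add

theorem mk_add (a : A) (x y : Dual K C) : mk K H a (x + y) = mk K H a x + mk K H a y :=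
  TensorProduct.tmul_add a x y

theorem add_mk (a b : A) (x : Dual K C) : mk K H (a + b) x = mk K H a x + mk K H b x :=
  TensorProduct.add_tmul a b x

theorem mk_smul (k : K) (a : A) (x : Dual K C) : mk K H a (k • x) = k • mk K H a x :=
  TensorProduct.tmul_smul k a x

theorem smul_mk (k : K) (a : A) (x : Dual K C) : mk K H (k • a) x = k • mk K H a x :=
  TensorProduct.smul_tmul' k a x

variable (H C) in
/-- The linear map `x ↦ a ♯ x`. -/
def mkHom (a : A) : Dual K C →ₗ[K] Smash K H A C :=
  (equiv K H A C).toLinearMap ∘ₗ TensorProduct.mk K A (Dual K C) a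

theorem mkHom_apply (a : A) (x : Dual K C) : mkHom H C a x = mk K H a x := rfl

/-- For fixed `a`, `x`, `y`, the map `b ⊗ h ↦ a b ♯ (x h) y`. -/
def twist (a : A) (x y : Dual K C) : A ⊗[K] H →ₗ[K] Smash K H A C :=
  (equiv K H A C).toLinearMap ∘ₗ
    TensorProduct.map (LinearMap.mulLeft K a) (LinearMap.mulRight K y ∘ₗ dualAct x)

theorem twist_tmul (a : A) (x y : Dual K C) (b : A) (h : H) :
    twist a x y (b ⊗ₜ[K] h) = mk K H (a * b) (dualAct x h * y) := rfl

theorem twist_add₁ (a a' : A) (x y : Dual K C) (t : A ⊗[K] H) :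
    twist (a + a') x y t = twist a x y t + twist a' x y t := by
  induction t with
  | zero => simp
  | add s t hs ht => rw [map_add, map_add, map_add, hs, ht]; abel
  | tmul b h => simp only [twist_tmul, add_mul, add_mk]

theorem twist_smul₁ (k : K) (a : A) (x y : Dual K C) (t : A ⊗[K] H) :
    twist (k • a) x y t = k • twist a x y t := by
  induction t with
  | zero => simp
  | add s t hs ht => rw [map_add, map_add, hs, ht, smul_add]
  | tmul b h => simp only [twist_tmul, smul_mul_assoc, smul_mk]

theorem twist_add₂ (a : A) (x x' y : Dual K C) (t : A ⊗[K] H) :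
    twist a (x + x') y t = twist a x y t + twist a x' y t := by
  induction t with
  | zero => simp
  | add s t hs ht => rw [map_add, map_add, map_add, hs, ht]; abel
  | tmul b h => simp only [twist_tmul, map_add, LinearMap.add_apply, add_mul, mk_add]

theorem twist_smul₂ (k : K) (a : A) (x y : Dual K C) (t : A ⊗[K] H) :
    twist a (k • x) y t = k • twist a x y t := by
  induction t with
  | zero => simp
  | add s t hs ht => rw [map_add, map_add, hs, ht, smul_add]
  | tmul b h => simp only [twist_tmul, map_smul, LinearMap.smul_apply, smul_mul_assoc, mk_smul]

theorem twist_add₃ (a : A) (x y y' : Dual K C) (t : A ⊗[K] H) :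
    twist a x (y + y') t = twist a x y t + twist a x y' t := by
  induction t with
  | zero => simp
  | add s t hs ht => rw [map_add, map_add, map_add, hs, ht]; abel
  | tmul b h => simp only [twist_tmul, mul_add, mk_add]

theorem twist_smul₃ (k : K) (a : A) (x y : Dual K C) (t : A ⊗[K] H) :
    twist a x (k • y) t = k • twist a x y t := by
  induction t with
  | zero => simp
  | add s t hs ht => rw [map_add, map_add, hs, ht, smul_add]
  | tmul b h => simp only [twist_tmul, mul_smul_comm, mk_smul]

variable [RightComoduleAlgebra K H A]

variable (K H) in
/-- The coaction `ρ(a) = ∑ a₀ ⊗ a₁` of a right comodule algebra. -/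
abbrev coact : A →ₐ[K] A ⊗[K] H := RightComoduleAlgebra.coact

/-- The bilinear product with `(a ♯ x)(b ♯ y) = ∑ a b₀ ♯ (x b₁) y`, where
`ρ(b) = ∑ b₀ ⊗ b₁`. -/
def mulAux : Smash K H A C →ₗ[K] Smash K H A C →ₗ[K] Smash K H A C :=
  TensorProduct.lift (M := A) (N := Dual K C) (LinearMap.mk₂ K
    (fun a x => TensorProduct.lift (M := A) (N := Dual K C) (LinearMap.mk₂ K
      (fun b y => twist a x y (coact K H b))
      (fun b b' y => by rw [map_add, map_add])
      (fun k b y => by rw [map_smul, map_smul])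
      (fun b y y' => twist_add₃ a x y y' _)
      (fun k b y => twist_smul₃ k a x y _)))
    (fun a a' x => TensorProduct.ext' fun b y => twist_add₁ a a' x y (coact K H b))
    (fun k a x => TensorProduct.ext' fun b y => twist_smul₁ k a x y (coact K H b))
    (fun a x x' => TensorProduct.ext' fun b y => twist_add₂ a x x' y (coact K H b))
    (fun k a x => TensorProduct.ext' fun b y => twist_smul₂ k a x y (coact K H b)))

instance : Mul (Smash K H A C) := ⟨fun s t => mulAux s t⟩

instance : One (Smash K H A C) := ⟨mk K H 1 1⟩

theorem mul_def (s t : Smash K H A C) : s * t = mulAux s t := rfl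

theorem one_def : (1 : Smash K H A C) = mk K H 1 1 := rfl

theorem mk_mul_mk (a b : A) (x y : Dual K C) :
    mk K H a x * mk K H b y = twist a x y (coact K H b) := rfl

protected theorem left_distrib (s t r : Smash K H A C) : s * (t + r) = s * t + s * r := by
  simp only [mul_def, map_add]

protected theorem right_distrib (s t r : Smash K H A C) : (s + t) * r = s * r + t * r := by
  simp only [mul_def, map_add, LinearMap.add_apply]

protected theorem zero_mul (s : Smash K H A C) : 0 * s = 0 := by
  simp only [mul_def, map_zero, LinearMap.zero_apply]

protected theorem mul_zero (s : Smash K H A C) : s * 0 = 0 := by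
  simp only [mul_def, map_zero]

variable [LeftModuleCoalgebra K H C]

theorem mk_one_mul_mk (a b : A) (y : Dual K C) : mk K H a 1 * mk K H b y = mk K H (a * b) y := by
  have key : ∀ t : A ⊗[K] H, twist a (1 : Dual K C) y t =
      mk K H (a * TensorProduct.rid K A ((Coalgebra.counit (R := K) (A := H)).lTensor A t)) y := by
    intro t
    induction t with
    | zero => simp [mk]
    | add s t hs ht => simp only [map_add, hs, ht, mul_add, add_mk]
    | tmul b h =>
      simp only [twist_tmul, one_dualAct, smul_mul_assoc, one_mul, mk_smul,
        LinearMap.lTensor_tmul, TensorProduct.rid_tmul, mul_smul_comm, smul_mk]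
  rw [mk_mul_mk, key, RightComoduleAlgebra.counit_coact]

theorem mk_mul_mk_one (a : A) (x y : Dual K C) : mk K H a x * mk K H 1 y = mk K H a (x * y) := by
  rw [mk_mul_mk, map_one, Algebra.TensorProduct.one_def, twist_tmul, mul_one, dualAct_one]

protected theorem one_mul (s : Smash K H A C) : 1 * s = s := by
  induction s using induction_on with
  | zero => exact Smash.mul_zero _
  | mk a x => rw [one_def, mk_one_mul_mk, one_mul]
  | add s t hs ht => rw [Smash.left_distrib, hs, ht]

protected theorem mul_one (s : Smash K H A C) : s * 1 = s := by
  induction s using induction_on with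
  | zero => exact Smash.zero_mul _
  | mk a x => rw [one_def, mk_mul_mk_one, mul_one]
  | add s t hs ht => rw [Smash.right_distrib, hs, ht]

/-- `(d ⊗ k) ⊗ l ↦ a d ♯ (x k)((y l) z)`, used for associativity. -/
def twist₂ (a : A) (x y z : Dual K C) : A ⊗[K] (H ⊗[K] H) →ₗ[K] Smash K H A C :=
  (equiv K H A C).toLinearMap ∘ₗ
    TensorProduct.map (LinearMap.mulLeft K a) (LinearMap.mulRight K z ∘ₗ dualActMul x y)

theorem twist₂_tmul (a : A) (x y z : Dual K C) (d : A) (k l : H) :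
    twist₂ a x y z (d ⊗ₜ[K] (k ⊗ₜ[K] l)) =
      mk K H (a * d) (dualAct x k * dualAct y l * z) := rfl

theorem twist_mul (a : A) (x y z : Dual K C) (d : A) :
    twist (H := H) a (x * y) z (coact K H d) =
      twist₂ a x y z ((Coalgebra.comul (R := K) (A := H)).lTensor A (coact K H d)) := by
  generalize coact K H d = t
  induction t with
  | zero => simp
  | add s t hs ht => simp only [map_add, hs, ht]
  | tmul d k =>
    rw [twist_tmul, mul_dualAct, LinearMap.lTensor_tmul]
    rfl

/-- `(d ⊗ h') ⊗ k ↦ ∑ a b d ♯ (x (h h'))((y k) z)` for `w = b ⊗ h`, used for associativity. -/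
def twist₃ (a : A) (x z : Dual K C) (w : A ⊗[K] H) (y : Dual K C) :
    (A ⊗[K] H) ⊗[K] H →ₗ[K] Smash K H A C :=
  TensorProduct.lift (LinearMap.mk₂ K (fun (u : A ⊗[K] H) (k : H) =>
      twist a x (dualAct y k * z) (w * u))
    (fun u v k => by rw [mul_add, map_add])
    (fun r u k => by rw [mul_smul_comm, map_smul])
    (fun u k l => by rw [map_add, add_mul, twist_add₃])
    (fun r u k => by rw [map_smul, smul_mul_assoc, twist_smul₃]))

theorem twist₃_tmul (a : A) (x z : Dual K C) (w : A ⊗[K] H) (y : Dual K C) (u : A ⊗[K] H)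
    (k : H) : twist₃ a x z w y (u ⊗ₜ[K] k) = twist a x (dualAct y k * z) (w * u) := rfl

theorem twist₃_add (a : A) (x z : Dual K C) (w w' : A ⊗[K] H) (y : Dual K C)
    (v : (A ⊗[K] H) ⊗[K] H) :
    twist₃ a x z (w + w') y v = twist₃ a x z w y v + twist₃ a x z w' y v := by
  induction v with
  | zero => simp
  | add s t hs ht => rw [map_add, map_add, map_add, hs, ht]; abel
  | tmul u k => rw [twist₃_tmul, twist₃_tmul, twist₃_tmul, add_mul, map_add]

theorem twist₃_zero (a : A) (x z : Dual K C) (y : Dual K C)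
    (v : (A ⊗[K] H) ⊗[K] H) : twist₃ a x z 0 y v = 0 := by
  induction v with
  | zero => simp
  | add s t hs ht => rw [map_add, hs, ht, add_zero]
  | tmul u k => rw [twist₃_tmul, zero_mul, map_zero]

theorem twist₃_pure (a : A) (x z : Dual K C) (b : A) (h : H) (y : Dual K C)
    (v : (A ⊗[K] H) ⊗[K] H) : twist₃ a x z (b ⊗ₜ[K] h) y v =
      twist₂ (a * b) (dualAct x h) y z (TensorProduct.assoc K A H H v) := by
  induction v with
  | zero => simp
  | add s t hs ht => rw [map_add, map_add, map_add, hs, ht]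
  | tmul u k =>
    rw [twist₃_tmul]
    induction u with
    | zero => simp
    | add s t hs ht => rw [mul_add, map_add, hs, ht, TensorProduct.add_tmul, map_add, map_add]
    | tmul d h' =>
      rw [Algebra.TensorProduct.tmul_mul_tmul, twist_tmul, TensorProduct.assoc_tmul,
        twist₂_tmul, dualAct_mul, mul_assoc, mul_assoc]

theorem mul_twist (a : A) (x z : Dual K C) (b : A) (y : Dual K C) (t : A ⊗[K] H) :
    mk K H a x * twist b y z t =
      twist₃ a x z (coact K H b) y ((coact K H).toLinearMap.rTensor H t) := by
  induction t with
  | zero => simp [Smash.mul_zero]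
  | add s t hs ht => simp only [map_add, Smash.left_distrib, hs, ht]
  | tmul d k =>
    rw [twist_tmul, mk_mul_mk, map_mul]
    rfl

theorem twist_mul_mk (a : A) (x z : Dual K C) (y : Dual K C) (t : A ⊗[K] H) (d : A) :
    twist a x y t * mk K H d z =
      twist₃ a x z t y ((coact K H).toLinearMap.rTensor H (coact K H d)) := by
  induction t with
  | zero => rw [map_zero, Smash.zero_mul, twist₃_zero]
  | add s t hs ht => rw [map_add, Smash.right_distrib, hs, ht, twist₃_add]
  | tmul b h =>
    rw [twist_tmul, mk_mul_mk, twist_mul, ← RightComoduleAlgebra.coassoc, twist₃_pure]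

protected theorem mul_assoc (s t r : Smash K H A C) : s * t * r = s * (t * r) := by
  induction s using induction_on with
  | zero => simp only [Smash.zero_mul]
  | add s s' hs hs' => simp only [Smash.right_distrib, hs, hs']
  | mk a x =>
  induction t using induction_on with
  | zero => simp only [Smash.zero_mul, Smash.mul_zero]
  | add s s' hs hs' => simp only [Smash.right_distrib, Smash.left_distrib, hs, hs']
  | mk b y =>
  induction r using induction_on with
  | zero => simp only [Smash.mul_zero]
  | add s s' hs hs' => simp only [Smash.left_distrib, hs, hs']
  | mk d z => rw [mk_mul_mk b d, mul_twist, mk_mul_mk, twist_mul_mk]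

instance : Ring (Smash K H A C) :=
  { (inferInstance : AddCommGroup (Smash K H A C)),
    (inferInstance : Mul (Smash K H A C)),
    (inferInstance : One (Smash K H A C)) with
    left_distrib := Smash.left_distrib
    right_distrib := Smash.right_distrib
    zero_mul := Smash.zero_mul
    mul_zero := Smash.mul_zero
    mul_assoc := Smash.mul_assoc
    one_mul := Smash.one_mul
    mul_one := Smash.mul_one }

instance : Algebra K (Smash K H A C) :=
  Algebra.ofModule
    (fun k s t => by simp only [mul_def, map_smul, LinearMap.smul_apply])
    (fun k s t => by simp only [mul_def, map_smul])

variable (K H A C) in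
/-- The algebra map `x ↦ 1 ♯ x` from `C*` to `A ♯ C*`. -/
def inclC : Dual K C →ₐ[K] Smash K H A C :=
  AlgHom.ofLinearMap ((equiv K H A C).toLinearMap ∘ₗ TensorProduct.mk K A (Dual K C) 1) rfl
    (fun x y => (mk_mul_mk_one (H := H) (1 : A) x y).symm)

variable (K H A C) in
/-- The algebra map `a ↦ a ♯ ε` from `A` to `A ♯ C*`. -/
def inclA : A →ₐ[K] Smash K H A C :=
  AlgHom.ofLinearMap
    ((equiv K H A C).toLinearMap ∘ₗ (TensorProduct.mk K A (Dual K C)).flip 1) rfl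
    (fun a b => (mk_one_mul_mk (H := H) a b (1 : Dual K C)).symm)

theorem inclC_apply (x : Dual K C) : inclC K H A C x = mk K H 1 x := rfl

theorem inclA_apply (a : A) : inclA K H A C a = mk K H a 1 := rfl

theorem inclA_mul_inclC (a : A) (x : Dual K C) :
    inclA K H A C a * inclC K H A C x = mk K H a x := by
  rw [inclC_apply, inclA_apply, mk_one_mul_mk, mul_one]

theorem inclC_mul_inclA (x : Dual K C) (a : A) :
    inclC K H A C x * inclA K H A C a = twist (H := H) 1 x 1 (coact K H a) := rfl

end Smash

end SmashProduct

section SmashModules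

variable {K H A C : Type u} [CommRing K] [Ring H] [HopfAlgebra K H] [Ring A] [Algebra K A]
  [RightComoduleAlgebra K H A] [AddCommGroup C] [Module K C] [Coalgebra K C] [Module H C]
  [IsScalarTower K H C] [LeftModuleCoalgebra K H C]

/-- Restriction of scalars of `A ♯ C*`-modules along `K → A ♯ C*`. -/
instance smashModuleBase (M : ModuleCat.{u} (Smash K H A C)) : Module K M :=
  Module.restrictScalars K (Smash K H A C) M

instance smashModuleBaseTower (M : ModuleCat.{u} (Smash K H A C)) :
    IsScalarTower K (Smash K H A C) M :=
  IsScalarTower.restrictScalars K (Smash K H A C) M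

/-- Restriction of scalars of `A ♯ C*`-modules along `A → A ♯ C*`. -/
instance smashModuleA (M : ModuleCat.{u} (Smash K H A C)) : Module A M :=
  Module.compHom M (Smash.inclA K H A C).toRingHom

/-- Restriction of scalars of `A ♯ C*`-modules along `C* → A ♯ C*`. -/
instance smashModuleDual (M : ModuleCat.{u} (Smash K H A C)) : Module (Dual K C) M :=
  Module.compHom M (Smash.inclC K H A C).toRingHom

theorem smash_smul_A {M : ModuleCat.{u} (Smash K H A C)} (a : A) (m : M) :
    a • m = Smash.inclA K H A C a • m := rfl

theorem smash_smul_dual {M : ModuleCat.{u} (Smash K H A C)} (x : Dual K C) (m : M) :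
    x • m = Smash.inclC K H A C x • m := rfl

theorem smash_mk_smul {M : ModuleCat.{u} (Smash K H A C)} (a : A) (x : Dual K C) (m : M) :
    Smash.mk K H a x • m = a • x • m := by
  rw [smash_smul_A, smash_smul_dual, smul_smul, Smash.inclA_mul_inclC]

instance smashModuleATower (M : ModuleCat.{u} (Smash K H A C)) : IsScalarTower K A M :=
  ⟨fun k a m => by rw [smash_smul_A, smash_smul_A, map_smul, smul_assoc]⟩

instance smashModuleDualTower (M : ModuleCat.{u} (Smash K H A C)) :
    IsScalarTower K (Dual K C) M :=
  ⟨fun k x m => by rw [smash_smul_dual, smash_smul_dual, map_smul, smul_assoc]⟩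

/-- The map `(b ⊗ h) ⊗ (m ⊗ c) ↦ b m ⊗ h c`. -/
def diagAct (M : Type u) [AddCommGroup M] [Module K M] [Module A M] [IsScalarTower K A M] :
    A ⊗[K] H →ₗ[K] M ⊗[K] C →ₗ[K] M ⊗[K] C :=
  TensorProduct.map₂ (act K A M) (act K H C)

theorem diagAct_tmul {M : Type u} [AddCommGroup M] [Module K M] [Module A M]
    [IsScalarTower K A M] (b : A) (h : H) (m : M) (c : C) :
    diagAct M (b ⊗ₜ[K] h) (m ⊗ₜ[K] c) = (b • m) ⊗ₜ[K] (h • c) := rfl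

theorem contract_diagAct {M : Type u} [AddCommGroup M] [Module K M] [Module A M]
    [IsScalarTower K A M] (x : Dual K C) (b : A) (h : H) (t : M ⊗[K] C) :
    contract M x (diagAct M (b ⊗ₜ[K] h) t) = b • contract M (dualAct x h) t := by
  induction t with
  | zero => simp
  | add s t hs ht => simp only [map_add, hs, ht, smul_add]
  | tmul m c => rw [diagAct_tmul, contract_tmul, contract_tmul, dualAct_apply, smul_comm]

theorem dual_smul_A_smul {M : ModuleCat.{u} (Smash K H A C)} (x : Dual K C) (a : A) (m : M)
    (t : M ⊗[K] C) (ht : ∀ x : Dual K C, x • m = contract M x t) :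
    x • a • m = contract M x (diagAct M (Smash.coact K H a) t) := by
  rw [smash_smul_A, smash_smul_dual, smul_smul, Smash.inclC_mul_inclA]
  generalize Smash.coact K H a = w
  induction w with
  | zero => simp
  | add s t hs ht => simp only [map_add, LinearMap.add_apply, add_smul, hs, ht]
  | tmul b h =>
    rw [Smash.twist_tmul, one_mul, mul_one, smash_mk_smul, ht, contract_diagAct]

/-- `Rat_C(M)` as an `A ♯ C*`-submodule of the `A ♯ C*`-module `M`. -/
def ratS (M : ModuleCat.{u} (Smash K H A C)) : Submodule (Smash K H A C) M where
  carrier := ratC K C M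
  add_mem' := (ratC K C M).add_mem
  zero_mem' := (ratC K C M).zero_mem
  smul_mem' s m hm := by
    induction s using Smash.induction_on with
    | zero => rw [zero_smul]; exact (ratC K C M).zero_mem
    | add s t hs ht => rw [add_smul]; exact (ratC K C M).add_mem hs ht
    | mk a x =>
      rw [smash_mk_smul]
      obtain ⟨t, ht⟩ := (isRational_iff _).1 ((ratC K C M).smul_mem x hm)
      exact (isRational_iff _).2 ⟨_, fun y => dual_smul_A_smul y a _ t ht⟩

/-- The bilinear form `A ⊗ C × A ♯ C* → A`, `⟨a ⊗ c, b ♯ x⟩ = x(c) b a`. Read in the opposite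
algebra `Aᵒᵖ` it is `aᵒ bᵒ x(c)`. -/
def pairing : A ⊗[K] C →ₗ[K] Smash K H A C →ₗ[K] A :=
  TensorProduct.lift (LinearMap.mk₂ K
    (fun a c => TensorProduct.lift (M := A) (N := Dual K C) (LinearMap.mk₂ K
      (fun b x => x c • (b * a))
      (fun b b' x => by rw [add_mul, smul_add])
      (fun k b x => by rw [smul_mul_assoc, smul_comm])
      (fun b x y => by rw [WithConv.ofConv_add, LinearMap.add_apply, add_smul])
      (fun k b x => by rw [WithConv.ofConv_smul, LinearMap.smul_apply, smul_assoc])))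
    (fun a a' c => TensorProduct.ext' fun b x => by
      change x c • (b * (a + a')) = x c • (b * a) + x c • (b * a')
      rw [mul_add, smul_add])
    (fun k a c => TensorProduct.ext' fun b x => by
      change x c • (b * (k • a)) = k • x c • (b * a)
      rw [mul_smul_comm, smul_comm])
    (fun a c c' => TensorProduct.ext' fun b x => by
      change x (c + c') • (b * a) = x c • (b * a) + x c' • (b * a)
      rw [map_add, add_smul])
    (fun k a c => TensorProduct.ext' fun b x => by
      change x (k • c) • (b * a) = k • x c • (b * a)
      rw [map_smul, smul_assoc]))

theorem pairing_apply (a b : A) (c : C) (x : Dual K C) :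
    pairing (H := H) (a ⊗ₜ[K] c) (Smash.mk K H b x) = x c • (b * a) := rfl

theorem exists_pairing_mul (z : A ⊗[K] C) (s : Smash K H A C) :
    ∃ z' : A ⊗[K] C, ∀ t : Smash K H A C, pairing z (t * s) = pairing z' t := by
  suffices h : ∃ z' : A ⊗[K] C, ∀ (b : A) (x : Dual K C),
      pairing z (Smash.mk K H b x * s) = pairing z' (Smash.mk K H b x) by
    obtain ⟨z', h⟩ := h
    refine ⟨z', fun t => ?_⟩
    induction t using Smash.induction_on with
    | zero => simp
    | add t t' ht ht' => rw [add_mul, map_add, map_add, ht, ht']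
    | mk b x => exact h b x
  induction s using Smash.induction_on with
  | zero => exact ⟨0, by simp⟩
  | add s t hs ht =>
    obtain ⟨z', h⟩ := hs
    obtain ⟨z'', h'⟩ := ht
    exact ⟨z' + z'', fun b x => by
      rw [mul_add, map_add, h, h', map_add, LinearMap.add_apply]⟩
  | mk d y =>
  induction z with
  | zero => exact ⟨0, by simp⟩
  | add s t hs ht =>
    obtain ⟨z', h⟩ := hs
    obtain ⟨z'', h'⟩ := ht
    exact ⟨z' + z'', fun b x => by
      rw [map_add, LinearMap.add_apply, h, h', map_add, LinearMap.add_apply]⟩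
  | tmul a c =>
  simp only [Smash.mk_mul_mk]
  generalize Smash.coact K H d = w
  induction w with
  | zero => exact ⟨0, by simp⟩
  | add s t hs ht =>
    obtain ⟨z', h⟩ := hs
    obtain ⟨z'', h'⟩ := ht
    exact ⟨z' + z'', fun b x => by
      rw [map_add, map_add, h, h', map_add, LinearMap.add_apply]⟩
  | tmul d h =>
  simp only [Smash.twist_tmul, pairing_apply, LinearMap.convMul_apply]
  generalize Coalgebra.comul (R := K) c = v
  induction v with
  | zero => exact ⟨0, by simp⟩
  | add s t hs ht =>
    obtain ⟨z', h⟩ := hs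
    obtain ⟨z'', h'⟩ := ht
    exact ⟨z' + z'', fun b x => by
      rw [map_add, map_add, add_smul, h, h', map_add, LinearMap.add_apply]⟩
  | tmul c c' =>
    refine ⟨(y c' • (d * a)) ⊗ₜ[K] (h • c), fun b x => ?_⟩
    rw [pairing_apply, TensorProduct.map_tmul, LinearMap.mul'_apply, mul_smul, mul_smul_comm,
      mul_assoc]
    rfl

variable (K H A C) in
/-- `Rat^T(M)` for the pairing `⟨-,-⟩` between `A ⊗ C` and `(A ♯ C*)ᵒᵖ`. Right modules over
`(A ♯ C*)ᵒᵖ` are written as left `A ♯ C*`-modules, so `m` is rational if there are finitely many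
`(zᵢ, mᵢ)` with `s m = ∑ ⟨zᵢ, s⟩ mᵢ` for all `s ∈ A ♯ C*`. -/
def ratT (M : Type u) [AddCommGroup M] [Module (Smash K H A C) M] :
    Submodule (Smash K H A C) M where
  carrier := {m | ∃ (n : ℕ) (z : Fin n → A ⊗[K] C) (m' : Fin n → M), ∀ s : Smash K H A C,
    s • m = ∑ i, Smash.inclA K H A C (pairing (z i) s) • m' i}
  add_mem' := by
    rintro a b ⟨n, z, m, h⟩ ⟨k, w, m', h'⟩
    refine ⟨n + k, Fin.append z w, Fin.append m m', fun s => ?_⟩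
    simp [Fin.sum_univ_add, h, h']
  zero_mem' := ⟨0, Fin.elim0, Fin.elim0, by simp⟩
  smul_mem' := by
    rintro s m ⟨n, z, m', h⟩
    choose z' hz' using fun i => exists_pairing_mul (z i) s
    refine ⟨n, z', m', fun t => ?_⟩
    rw [smul_smul, h]
    simp only [hz']

theorem ratT_map {M M' : Type u} [AddCommGroup M] [Module (Smash K H A C) M] [AddCommGroup M']
    [Module (Smash K H A C) M'] (f : M →ₗ[Smash K H A C] M') {m : M} (hm : m ∈ ratT K H A C M) :
    f m ∈ ratT K H A C M' := by
  obtain ⟨n, z, m', h⟩ := hm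
  refine ⟨n, z, fun i => f (m' i), fun s => ?_⟩
  rw [← map_smul, h, map_sum]
  simp only [map_smul]

variable (K H A C) in
/-- The ideal `𝔞 = Rat^T(B_B)` of `B = (A ♯ C*)ᵒᵖ`, as a left ideal of `A ♯ C*`. -/
def ratIdeal : Submodule (Smash K H A C) (Smash K H A C) := ratT K H A C (Smash K H A C)

theorem ratIdeal_mul_mem {u : Smash K H A C} (hu : u ∈ ratIdeal K H A C) (s : Smash K H A C) :
    u * s ∈ ratIdeal K H A C :=
  ratT_map (LinearMap.toSpanSingleton (Smash K H A C) (Smash K H A C) s) hu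

theorem mk_one_mem_ratIdeal {y : Dual K C} (hy : y ∈ ratC K C (Dual K C)) :
    Smash.mk K H (1 : A) y ∈ ratIdeal K H A C := by
  obtain ⟨n, c, y', h⟩ := hy
  refine ⟨n, fun i => 1 ⊗ₜ c i, fun i => Smash.mk K H 1 (y' i), fun s => ?_⟩
  induction s using Smash.induction_on with
  | zero => simp
  | add s t hs ht =>
    rw [add_smul, hs, ht, ← Finset.sum_add_distrib]
    simp only [map_add, add_smul]
  | mk b x =>
    rw [smul_eq_mul, Smash.mk_mul_mk_one, ← smul_eq_mul, h, ← Smash.mkHom_apply, map_sum]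
    refine Finset.sum_congr rfl fun i _ => ?_
    change _ = Smash.inclA K H A C (x (c i) • (b * 1)) * Smash.mk K H 1 (y' i)
    rw [map_smul, map_smul, Smash.mkHom_apply, smul_mul_assoc, Smash.inclA_apply,
      Smash.mk_one_mul_mk, mul_one, mul_one]

variable (K H A C) in
/-- The canonical map `A ⊗ Rat_C(C*) → A ⊗ C* = A ♯ C*`. -/
def tensorRat : A ⊗[K] ((ratC K C (Dual K C)).restrictScalars K) →ₗ[K] Smash K H A C :=
  (Smash.equiv K H A C).toLinearMap ∘ₗ
    ((ratC K C (Dual K C)).restrictScalars K).subtype.lTensor A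

/-- The map `Hom_B(𝔞, M) → Hom_{C*}(Rat_C(C*), M)`, `f ↦ (y ↦ f(1 ♯ y))`. -/
def hat (M : ModuleCat.{u} (Smash K H A C)) :
    (ratIdeal K H A C →ₗ[Smash K H A C] M) →ₗ[K] (ratC K C (Dual K C) →ₗ[Dual K C] M) where
  toFun f :=
    { toFun := fun y => f ⟨Smash.mk K H 1 y.1, mk_one_mem_ratIdeal y.2⟩
      map_add' := fun y z => by
        rw [← map_add]
        congr 1
        exact Subtype.ext (Smash.mk_add 1 y.1 z.1)
      map_smul' := fun x y => by
        rw [RingHom.id_apply, smash_smul_dual, ← map_smul]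
        congr 1
        exact Subtype.ext (Smash.mk_mul_mk_one 1 x y.1).symm }
  map_add' _ _ := rfl
  map_smul' _ _ := rfl

/-- The left `A ♯ C*`-module structure `(s f)(u) = f(u s)` on `Hom_{A ♯ C*}(𝔞, M)`, coming from
the right multiplication on the two-sided ideal `𝔞`. -/
abbrev homIdealModule (M : ModuleCat.{u} (Smash K H A C)) :
    Module (Smash K H A C) (ratIdeal K H A C →ₗ[Smash K H A C] M) where
  smul s f :=
    { toFun := fun u => f ⟨u.1 * s, ratIdeal_mul_mem u.2 s⟩
      map_add' := fun u v => by
        rw [← map_add]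
        congr 1
        exact Subtype.ext (add_mul u.1 v.1 s)
      map_smul' := fun r u => by
        rw [RingHom.id_apply, ← map_smul]
        congr 1
        exact Subtype.ext (mul_assoc r u.1 s) }
  one_smul f := LinearMap.ext fun u => congrArg f (Subtype.ext (mul_one u.1))
  mul_smul s t f := LinearMap.ext fun u => congrArg f (Subtype.ext (mul_assoc u.1 s t).symm)
  smul_zero s := rfl
  smul_add s f g := rfl
  add_smul s t f := LinearMap.ext fun u => by
    refine Eq.trans ?_ (f.map_add _ _)
    exact congrArg f (Subtype.ext (mul_add u.1 s t))
  zero_smul f := LinearMap.ext fun u => by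
    refine Eq.trans ?_ f.map_zero
    exact congrArg f (Subtype.ext (mul_zero u.1))

section Transfer

variable (hb : ∀ M : ModuleCat.{u} (Smash K H A C), Function.Bijective (hat M))

/-- The `A ♯ C*`-module structure on `Hom_{C*}(Rat_C(C*), M)` transferred from
`Hom_{A ♯ C*}(𝔞, M)` along the bijection `f ↦ (y ↦ f(1 ♯ y))`. -/
abbrev homRatModule (M : ModuleCat.{u} (Smash K H A C)) :
    Module (Smash K H A C) (ratC K C (Dual K C) →ₗ[Dual K C] M) :=
  letI := homIdealModule M
  (AddEquiv.ofBijective (hat M).toAddMonoidHom (hb M)).symm.module (Smash K H A C)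

theorem homRat_smul_hat (M : ModuleCat.{u} (Smash K H A C)) (s : Smash K H A C)
    (f : ratIdeal K H A C →ₗ[Smash K H A C] M) :
    (homRatModule hb M).toSMul.smul s (hat M f) =
      hat M ((homIdealModule M).toSMul.smul s f) := by
  let e := AddEquiv.ofBijective (hat M).toAddMonoidHom (hb M)
  exact congrArg (fun g => e ((homIdealModule M).toSMul.smul s g)) (e.symm_apply_apply f)

/-- An `A ♯ C*`-linear map, regarded as a `C*`-linear map. -/
def toDualLinear {M N : ModuleCat.{u} (Smash K H A C)} (φ : M ⟶ N) : M →ₗ[Dual K C] N where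
  toFun := φ.hom
  map_add' := φ.hom.map_add
  map_smul' x m := φ.hom.map_smul (Smash.inclC K H A C x) m

/-- The functor `M ↦ Hom_{C*}(Rat_C(C*), M)` from left `A ♯ C*`-modules to left
`A ♯ C*`-modules, with the transferred module structures. -/
def homRat : ModuleCat.{u} (Smash K H A C) ⥤ ModuleCat.{u} (Smash K H A C) where
  obj M := @ModuleCat.of (Smash K H A C) _ (ratC K C (Dual K C) →ₗ[Dual K C] M) _
    (homRatModule hb M)
  map {M N} φ :=
    letI := homRatModule hb M
    letI := homRatModule hb N
    ModuleCat.ofHom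
      { toFun := fun g => toDualLinear φ ∘ₗ g
        map_add' := fun g g' => LinearMap.comp_add _ _ _
        map_smul' := fun s g => by
          obtain ⟨f, rfl⟩ := (hb M).2 g
          refine (congrArg (fun g => toDualLinear φ ∘ₗ g) (homRat_smul_hat hb M s f)).trans ?_
          exact (homRat_smul_hat hb N s (φ.hom ∘ₗ f)).symm }
  map_id _ := rfl
  map_comp _ _ := rfl

end Transfer

end SmashModules

section DoiKoppinenModules

variable (K H A C : Type u) [CommRing K] [Ring H] [HopfAlgebra K H] [Ring A] [Algebra K A]
  [RightComoduleAlgebra K H A] [AddCommGroup C] [Module K C] [Coalgebra K C] [Module H C]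
  [IsScalarTower K H C] [LeftModuleCoalgebra K H C]

/-- A Doi-Koppinen module: a left `A`-module and right `C`-comodule `M` with
`ρ(a m) = ∑ a₀ m₀ ⊗ a₁ m₁`. -/
structure DKModule : Type (u + 1) where
  carrier : Type u
  [addCommGroup : AddCommGroup carrier]
  [moduleBase : Module K carrier]
  [moduleA : Module A carrier]
  [tower : IsScalarTower K A carrier]
  coact : carrier →ₗ[K] carrier ⊗[K] C
  coassoc : ∀ m, TensorProduct.assoc K carrier C C (coact.rTensor C (coact m)) =
    (Coalgebra.comul (R := K) (A := C)).lTensor carrier (coact m)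
  counit_coact : ∀ m, TensorProduct.rid K carrier
    ((Coalgebra.counit (R := K) (A := C)).lTensor carrier (coact m)) = m
  coact_smul : ∀ (a : A) (m : carrier),
    coact (a • m) = diagAct carrier (Smash.coact K H a) (coact m)

namespace DKModule

attribute [instance] addCommGroup moduleBase moduleA tower

variable {K H A C}

/-- A morphism of Doi-Koppinen modules: an `A`-linear and `C`-colinear map. -/
@[ext]
structure Hom (M N : DKModule K H A C) : Type u where
  toLin : M.carrier →ₗ[A] N.carrier
  colinear : ∀ m, N.coact (toLin m) = (toLin.restrictScalars K).rTensor C (M.coact m)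

instance : Category.{u} (DKModule K H A C) where
  Hom M N := Hom M N
  id M := ⟨LinearMap.id, fun m => (LinearMap.rTensor_id_apply C M.carrier (M.coact m)).symm⟩
  comp f g := ⟨g.toLin ∘ₗ f.toLin, fun m => by
    rw [LinearMap.comp_apply, g.colinear, f.colinear, ← LinearMap.comp_apply,
      ← LinearMap.rTensor_comp]
    rfl⟩

variable (N : DKModule K H A C)

/-- The `C*`-action `x n = ∑ n₀ x(n₁)` of a comodule. -/
def dualSMul (x : Dual K C) : N.carrier →ₗ[K] N.carrier := contract N.carrier x ∘ₗ N.coact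

theorem dualSMul_mul (x y : Dual K C) (n : N.carrier) :
    N.dualSMul (x * y) n = N.dualSMul x (N.dualSMul y n) := by
  simp only [dualSMul, LinearMap.comp_apply]
  rw [contract_mul, ← N.coassoc, LinearEquiv.symm_apply_apply, contract_map]

theorem dualSMul_one (n : N.carrier) : N.dualSMul 1 n = n := by
  simp only [dualSMul, LinearMap.comp_apply]
  rw [contract_one, N.counit_coact]

/-- The action `(a ♯ x) n = a (x n)` of `A ♯ C*` on a Doi-Koppinen module. -/
def smashSMul : Smash K H A C →ₗ[K] Module.End K N.carrier :=
  TensorProduct.lift (M := A) (N := Dual K C) (LinearMap.mk₂ K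
    (fun a x => act K A N.carrier a ∘ₗ N.dualSMul x)
    (fun a b x => by rw [map_add, LinearMap.add_comp])
    (fun k a x => by rw [map_smul, LinearMap.smul_comp])
    (fun a x y => by
      rw [dualSMul, contract_add, LinearMap.add_comp, LinearMap.comp_add]; rfl)
    (fun k a x => by
      rw [dualSMul, contract_smul, LinearMap.smul_comp, LinearMap.comp_smul]; rfl))

theorem smashSMul_mk (a : A) (x : Dual K C) (n : N.carrier) :
    N.smashSMul (Smash.mk K H a x) n = a • N.dualSMul x n := rfl

theorem smashSMul_mul (s t : Smash K H A C) :
    N.smashSMul (s * t) = N.smashSMul s * N.smashSMul t := by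
  induction s using Smash.induction_on with
  | zero => simp
  | add s s' hs hs' => rw [add_mul, map_add, hs, hs', map_add, add_mul]
  | mk a x =>
  induction t using Smash.induction_on with
  | zero => simp
  | add s s' hs hs' => rw [mul_add, map_add, hs, hs', map_add, mul_add]
  | mk b y =>
    ext n
    rw [Module.End.mul_apply, smashSMul_mk, smashSMul_mk, dualSMul, LinearMap.comp_apply,
      N.coact_smul, Smash.mk_mul_mk]
    generalize Smash.coact K H b = w
    induction w with
    | zero => simp
    | add s t hs ht =>
      simp only [map_add, LinearMap.add_apply, smul_add, hs, ht]
    | tmul b h =>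
      rw [Smash.twist_tmul, smashSMul_mk, contract_diagAct, dualSMul_mul, mul_smul]
      rfl

/-- The action of `A ♯ C*` on a Doi-Koppinen module, as a ring homomorphism. -/
def smashRingHom : Smash K H A C →+* Module.End K N.carrier where
  toFun := N.smashSMul
  map_one' := by
    ext n
    rw [Smash.one_def, smashSMul_mk, one_smul, dualSMul_one]
    rfl
  map_mul' := N.smashSMul_mul
  map_zero' := map_zero _
  map_add' := map_add _

/-- The left `A ♯ C*`-module structure of a Doi-Koppinen module. -/
abbrev smashModule : Module (Smash K H A C) N.carrier := Module.compHom N.carrier N.smashRingHom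

theorem dualSMul_map {M N : DKModule K H A C} (f : M ⟶ N) (x : Dual K C) (m : M.carrier) :
    N.dualSMul x (Hom.toLin f m) = Hom.toLin f (M.dualSMul x m) := by
  rw [dualSMul, LinearMap.comp_apply, Hom.colinear, contract_map]
  rfl

theorem smashSMul_map {M N : DKModule K H A C} (f : M ⟶ N) (s : Smash K H A C)
    (m : M.carrier) : N.smashSMul s (Hom.toLin f m) = Hom.toLin f (M.smashSMul s m) := by
  induction s using Smash.induction_on with
  | zero => simp
  | add s t hs ht => simp only [map_add, LinearMap.add_apply, hs, ht]
  | mk a x => rw [smashSMul_mk, smashSMul_mk, dualSMul_map, map_smul]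

end DKModule

/-- The functor from Doi-Koppinen modules to left `A ♯ C*`-modules given by
`(a ♯ x) n = ∑ a n₀ x(n₁)`. -/
def dkToSmash : DKModule K H A C ⥤ ModuleCat.{u} (Smash K H A C) where
  obj N := @ModuleCat.of (Smash K H A C) _ N.carrier _ N.smashModule
  map {M N} f :=
    letI := M.smashModule
    letI := N.smashModule
    ModuleCat.ofHom
      { toFun := DKModule.Hom.toLin f
        map_add' := map_add _
        map_smul' := fun s m => (DKModule.smashSMul_map f s m).symm }
  map_id _ := rfl
  map_comp _ _ := rfl

variable {K H A C}

section RationalPart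

variable (M : ModuleCat.{u} (Smash K H A C))

/-- `Rat_C(M)` as an object of the category of left `A ♯ C*`-modules. -/
def ratObj : ModuleCat.{u} (Smash K H A C) := ModuleCat.of (Smash K H A C) (ratS M)

/-- The inclusion of `Rat_C(M)` in `M`. -/
def ratIncl : ratObj M →ₗ[Smash K H A C] M := (ratS M).subtype

theorem LocallyProjective.exists_coact (hC : LocallyProjective K C) (m : ratObj M) :
    ∃ t : (ratObj M) ⊗[K] C, ∀ x : Dual K C, contract (ratObj M) x t = x • m := by
  obtain ⟨n, c, m', hm⟩ := m.2
  obtain ⟨h, hh⟩ := hC.exists_lift (Submodule.span K (Set.range c))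
    (Submodule.fg_span (Set.finite_range c))
  classical
  have hinj : Function.Injective (ratIncl M) := Submodule.injective_subtype (ratS M)
  let S : Finset C := Finset.univ.biUnion fun i => (h (c i)).support
  let X : C → Dual K C := fun d => WithConv.toConv (Finsupp.lapply d ∘ₗ h)
  refine ⟨∑ d ∈ S, (X d • m) ⊗ₜ d, fun x => hinj ?_⟩
  have h2 : ∀ y : Dual K C, ratIncl M (y • m) = ∑ i, y (c i) • m' i := fun y => hm y
  have h3 : ∀ (k : K) (u : ratObj M), ratIncl M (k • u) = k • ratIncl M u := fun k u =>
    (ratIncl M).map_smul (algebraMap K _ k) u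
  have h4 : ∀ i, x (c i) = ∑ d ∈ S, h (c i) d * x d := by
    intro i
    conv_lhs => rw [← hh (c i) (Submodule.subset_span ⟨i, rfl⟩)]
    rw [Finsupp.linearCombination_apply, Finsupp.sum, map_sum]
    simp only [id, map_smul, smul_eq_mul]
    refine Finset.sum_subset (Finset.subset_biUnion_of_mem
      (fun i => (h (c i)).support) (Finset.mem_univ i)) fun d _ hd => ?_
    rw [Finsupp.notMem_support_iff.mp hd, zero_mul]
  rw [h2 x, map_sum, map_sum]
  simp only [contract_tmul, h3, h2, h4, Finset.sum_smul, Finset.smul_sum]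
  rw [Finset.sum_comm]
  refine Finset.sum_congr rfl fun i _ => Finset.sum_congr rfl fun d _ => ?_
  rw [smul_smul, mul_comm]
  rfl

/-- The `C`-coaction on `Rat_C(M)`: `ρ(m)` is the unique `∑ mᵢ ⊗ cᵢ` in `Rat_C(M) ⊗ C` with
`x m = ∑ x(cᵢ) mᵢ` for all `x ∈ C*`. -/
def ratCoact (hC : LocallyProjective K C) : ratObj M →ₗ[K] (ratObj M) ⊗[K] C where
  toFun m := (hC.exists_coact M m).choose
  map_add' m n := hC.ext fun x => by
    rw [map_add, (hC.exists_coact M _).choose_spec, (hC.exists_coact M _).choose_spec,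
      (hC.exists_coact M _).choose_spec, smul_add]
  map_smul' k m := hC.ext fun x => by
    rw [map_smul, (hC.exists_coact M _).choose_spec, (hC.exists_coact M _).choose_spec,
      RingHom.id_apply, smul_comm]

theorem contract_ratCoact (hC : LocallyProjective K C) (x : Dual K C) (m : ratObj M) :
    contract (ratObj M) x (ratCoact M hC m) = x • m :=
  (hC.exists_coact M m).choose_spec x

/-- `Rat_C(M)` as a Doi-Koppinen module, for a left `A ♯ C*`-module `M`. -/
def ratDKObj (hC : LocallyProjective K C) : DKModule K H A C where
  carrier := ratObj M
  coact := ratCoact M hC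
  coassoc m := by
    rw [← LinearEquiv.eq_symm_apply]
    refine hC.ext fun y => hC.ext fun x => ?_
    rw [contract_map, contract_ratCoact, contract_ratCoact, ← contract_mul, contract_ratCoact,
      mul_smul]
  counit_coact m := by rw [← contract_one, contract_ratCoact, one_smul]
  coact_smul a m := hC.ext fun x => by
    rw [contract_ratCoact]
    exact dual_smul_A_smul x a m _ fun y => (contract_ratCoact M hC y m).symm

end RationalPart

/-- The restriction `Rat_C(M) → Rat_C(M')` of an `A ♯ C*`-linear map `M → M'`. -/
def ratObjMap {M M' : ModuleCat.{u} (Smash K H A C)} (φ : M ⟶ M') :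
    ratS M →ₗ[Smash K H A C] ratS M' :=
  φ.hom.restrict fun _ hm => ratC_map (toDualLinear φ) hm

variable (H A) in
/-- The functor `Rat_C` from left `A ♯ C*`-modules to Doi-Koppinen modules. -/
def ratDK (hC : LocallyProjective K C) :
    ModuleCat.{u} (Smash K H A C) ⥤ DKModule K H A C where
  obj M := ratDKObj M hC
  map {M M'} φ :=
    { toLin :=
        { toFun := ratObjMap φ
          map_add' := map_add _
          map_smul' := fun a m => (ratObjMap φ).map_smul (Smash.inclA K H A C a) m }
      colinear := fun m => hC.ext fun x => by
        rw [contract_map]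
        refine (contract_ratCoact M' hC x (ratObjMap φ m)).trans ?_
        refine Eq.trans ?_ (congrArg (ratObjMap φ) (contract_ratCoact M hC x m).symm)
        exact ((ratObjMap φ).map_smul (Smash.inclC K H A C x) m).symm }
  map_id _ := rfl
  map_comp _ _ := rfl

end DoiKoppinenModules

end DoiKoppinen

end

/-! The proof rests on local units. Let `m` be a rational element of a left `C*`-module. Local
projectivity gives `x m = ∑ x(dⱼ) Xⱼ m` with `Xⱼ ∈ C*`, so `m` is already rational in `C* m`.
Exactness of `Rat_C` on `0 → Ann(m) → C* → C* m → 0` then lifts `m` to some `e ∈ Rat_C(C*)` with `e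
m = m` (`exists_mem_ratC_smul_eq`).

For (a), the antipode identity `x (y h) = ∑ ((x S(h₁)) y) h₂` (`mul_dualAct_right`) shows that
`Rat_C(C*)` is stable under `H`. Being also a two-sided ideal, it satisfies `(1 ♯ e) u ∈ A ⊗
Rat_C(C*)` for all `e` in it and all `u`. An element `u` of `𝔞` is rational over `C*`, hence equal
to some `(1 ♯ e) u`, which gives the nontrivial inclusion.

For (b), the elements `1 ♯ y` generate `𝔞` as a left ideal, whence injectivity. Flatness of `A`
makes `a ♯ y ↦ a g(y)` well defined on `𝔞`, whence surjectivity.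

For (c), a map `φ` from `Rat_C(M)` to `N` corresponds to `m ↦ (y ↦ φ(y m))`. The key formula is `z g
= (y ↦ y g(z))` for `z ∈ Rat_C(C*)` (`mk_one_smul_homRat`). If `ψ` maps `M` to `Hom_{C*}(Rat_C(C*),
N)` and `r = e r` is rational, it gives `ψ(r) = (y ↦ y n)` with `n = ψ(r)(e)`. Local units on `N`
make `n` unique, so `φ(r) = n` recovers `φ`. Local projectivity identifies `A ♯ C*`-linear maps
between Doi-Koppinen modules with their morphisms. -/

noncomputable section

namespace DoiKoppinen

/-! ### Local units for rational elements -/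

/-- The short exact sequence `0 → Ann(m) → R → R m → 0`. -/
def cyclicComplex (R : Type u) [Ring R] {M : Type u} [AddCommGroup M] [Module R M] (m : M) :
    ShortComplex (ModuleCat.{u} R) :=
  ShortComplex.mk
    (ModuleCat.ofHom (LinearMap.ker (LinearMap.toSpanSingleton R M m).rangeRestrict).subtype)
    (ModuleCat.ofHom (LinearMap.toSpanSingleton R M m).rangeRestrict)
    (by
      rw [← ModuleCat.ofHom_comp, LinearMap.comp_ker_subtype]
      rfl)

theorem cyclicComplex_shortExact (R : Type u) [Ring R] {M : Type u} [AddCommGroup M] [Module R M]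
    (m : M) : (cyclicComplex R m).ShortExact where
  exact := (ShortComplex.ShortExact.moduleCat_exact_iff_function_exact _).2
    (LinearMap.exact_subtype_ker_map (LinearMap.toSpanSingleton R M m).rangeRestrict)
  mono_f := (ModuleCat.mono_iff_injective _).2
    (LinearMap.ker (LinearMap.toSpanSingleton R M m).rangeRestrict).injective_subtype
  epi_g := (ModuleCat.epi_iff_surjective _).2
    (LinearMap.toSpanSingleton R M m).surjective_rangeRestrict

section RationalElements

variable {K C : Type u} [CommRing K] [AddCommGroup C] [Module K C] [Coalgebra K C]
  {M : Type u} [AddCommGroup M] [Module K M] [Module (Dual K C) M]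
  [IsScalarTower K (Dual K C) M]

/-- Over a locally projective coalgebra a rational element is rational in the cyclic module that
it generates. -/
theorem LocallyProjective.exists_smul_eq_sum (hC : LocallyProjective K C) {m : M}
    (hm : m ∈ ratC K C M) : ∃ (n : ℕ) (d : Fin n → C) (X : Fin n → Dual K C),
      ∀ x : Dual K C, x • m = ∑ j, x (d j) • X j • m := by
  classical
  obtain ⟨n, c, m', hm⟩ := hm
  obtain ⟨h, hh⟩ := hC.exists_lift (Submodule.span K (Set.range c))
    (Submodule.fg_span (Set.finite_range c))
  -- `X d` is the `d`-th coordinate of a local lift `h` of the identity of `C`, and `S` collects the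
  -- finitely many `d` that occur. Expanding each `c i` in these coordinates and exchanging sums
  -- turns the coefficients `m' i` into `X d • m`.
  let S : Finset C := Finset.univ.biUnion fun i => (h (c i)).support
  let X : C → Dual K C := fun d => WithConv.toConv (Finsupp.lapply d ∘ₗ h)
  have hx : ∀ (x : Dual K C) (i : Fin n), x (c i) = ∑ d ∈ S, h (c i) d * x d := by
    intro x i
    conv_lhs => rw [← hh (c i) (Submodule.subset_span ⟨i, rfl⟩)]
    rw [Finsupp.linearCombination_apply, Finsupp.sum, map_sum]
    simp only [id, map_smul, smul_eq_mul]
    refine Finset.sum_subset (Finset.subset_biUnion_of_mem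
      (fun i => (h (c i)).support) (Finset.mem_univ i)) fun d _ hd => ?_
    rw [Finsupp.notMem_support_iff.mp hd, zero_mul]
  refine ⟨S.card, fun j => S.equivFin.symm j, fun j => X (S.equivFin.symm j), fun x => ?_⟩
  rw [Equiv.sum_comp S.equivFin.symm fun d : S => x d.1 • X d.1 • m,
    Finset.sum_coe_sort S fun d => x d • X d • m, hm]
  simp only [hm, hx x, Finset.sum_smul, Finset.smul_sum]
  rw [Finset.sum_comm]
  refine Finset.sum_congr rfl fun d _ => Finset.sum_congr rfl fun i _ => ?_
  rw [smul_smul, mul_comm]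
  rfl

/-- If `Rat_C` is exact, each rational element is fixed by an element of `Rat_C(C*)`. -/
theorem exists_mem_ratC_smul_eq (hC : LocallyProjective K C) (hRat : RatExact K C) {m : M}
    (hm : m ∈ ratC K C M) : ∃ e ∈ ratC K C (Dual K C), e • m = m := by
  obtain ⟨n, d, X, hX⟩ := hC.exists_smul_eq_sum hm
  -- Only right exactness is needed: `Rat_C(C*) → Rat_C(C* m)` is onto.
  have hs := (ModuleCat.epi_iff_surjective _).1
    (hRat _ (cyclicComplex_shortExact (Dual K C) m)).epi_g
  have hval : ∀ x : Dual K C, ((cyclicComplex (Dual K C) m).g x).1 = x • m := fun _ => rfl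
  -- The generator must be rational with coefficients in `C* m`, not merely in `M`; the coefficients
  -- `X j • m` provide this.
  have hm' : IsRational K C (M := (cyclicComplex (Dual K C) m).X₃)
      ((cyclicComplex (Dual K C) m).g (1 : Dual K C)) := by
    refine ⟨n, d, fun j => (cyclicComplex (Dual K C) m).g (X j), fun x => Subtype.ext ?_⟩
    have hl : ((x • (cyclicComplex (Dual K C) m).g (1 : Dual K C) :
        (cyclicComplex (Dual K C) m).X₃).1 : M) = x • m :=
      congrArg (x • ·) (one_smul (Dual K C) m)
    refine hl.trans ((hX x).trans ?_)
    refine Eq.trans ?_ (map_sum (LinearMap.range (LinearMap.toSpanSingleton (Dual K C) M m)).subtype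
      _ _).symm
    refine Finset.sum_congr rfl fun j _ => ?_
    -- On the objects of the module category `K` acts through `K → C*`; this is matched with the
    -- given `K`-action.
    exact (algebraMap_smul (Dual K C) (x (d j)) (X j • m)).symm
  obtain ⟨⟨e, n', c', m', he⟩, h⟩ := hs ⟨_, hm'⟩
  refine ⟨e, ⟨n', c', m', fun x => (he x).trans ?_⟩, ?_⟩
  · refine Finset.sum_congr rfl fun j _ => ?_
    exact algebraMap_smul (M := Dual K C) (Dual K C) (x (c' j)) (m' j)
  · have := congrArg (fun z => (z.1.1 : M)) h
    exact this.trans (one_smul (Dual K C) m)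

end RationalElements

/-! ### Stability of `Rat_C(C*)` under right multiplication and under `H` -/

variable {K H A C : Type u} [CommRing K] [Ring H] [HopfAlgebra K H] [Ring A] [Algebra K A]
  [AddCommGroup C] [Module K C] [Coalgebra K C] [Module H C] [IsScalarTower K H C]

/-- Right multiplication by `z` is an endomorphism of the left `C*`-module `C*`, and such maps
preserve rationality. -/
theorem mul_mem_ratC {y : Dual K C} (hy : y ∈ ratC K C (Dual K C)) (z : Dual K C) :
    y * z ∈ ratC K C (Dual K C) :=
  ratC_map (LinearMap.toSpanSingleton (Dual K C) (Dual K C) z) hy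

/-- The map `k ⊗ l ↦ ((x S(k)) y) l`. -/
def antipodeTwist (x y : Dual K C) : H ⊗[K] H →ₗ[K] Dual K C :=
  TensorProduct.lift
    (dualAct ∘ₗ LinearMap.mulRight K y ∘ₗ dualAct x ∘ₗ HopfAlgebra.antipode K)

theorem antipodeTwist_tmul (x y : Dual K C) (k l : H) : antipodeTwist x y (k ⊗ₜ[K] l) =
    dualAct (dualAct x (HopfAlgebra.antipode K k) * y) l := rfl

/-- The map `(k ⊗ l) ⊗ m ↦ (x (S(k) l))(y m)`. -/
def antipodeTwist₂ (x y : Dual K C) : (H ⊗[K] H) ⊗[K] H →ₗ[K] Dual K C :=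
  LinearMap.mul' K (Dual K C) ∘ₗ TensorProduct.map
    (dualAct x ∘ₗ LinearMap.mul' K H ∘ₗ (HopfAlgebra.antipode K).rTensor H) (dualAct y)

theorem antipodeTwist₂_tmul (x y : Dual K C) (t : H ⊗[K] H) (m : H) :
    antipodeTwist₂ x y (t ⊗ₜ[K] m) =
      dualAct x (LinearMap.mul' K H ((HopfAlgebra.antipode K).rTensor H t)) * dualAct y m := rfl

/-- The antipode axiom `∑ S(k₁) k₂ = ε(k)` collapses the factor that acts on `x`. -/
theorem antipodeTwist₂_rTensor_comul (x y : Dual K C) (t : H ⊗[K] H) :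
    antipodeTwist₂ x y ((Coalgebra.comul (R := K) (A := H)).rTensor H t) =
      x * dualAct y (TensorProduct.lid K H
        ((Coalgebra.counit (R := K) (A := H)).rTensor H t)) := by
  induction t with
  | zero => simp
  | add s t hs ht => simp only [map_add, hs, ht, mul_add]
  | tmul k l =>
    rw [LinearMap.rTensor_tmul, antipodeTwist₂_tmul,
      HopfAlgebra.mul_antipode_rTensor_comul_apply, LinearMap.rTensor_tmul,
      TensorProduct.lid_tmul, Algebra.algebraMap_eq_smul_one, map_smul, map_smul, dualAct_one,
      smul_mul_assoc, mul_smul_comm]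

/-- Tells how coefficients `∑ yᵢ ⊗ cᵢ` change when `x` is acted on by `h` and the result by `k`:
they become `∑ yᵢ k ⊗ h cᵢ`. -/
theorem contract_dualAct (x : Dual K C) (h k : H) (t : Dual K C ⊗[K] C) :
    contract (Dual K C) x (TensorProduct.map (dualAct.flip k) (act K H C h) t) =
      dualAct (contract (Dual K C) (dualAct x h) t) k := by
  induction t with
  | zero => simp
  | add s t hs ht => simp only [map_add, hs, ht, LinearMap.add_apply]
  | tmul y c =>
    rw [TensorProduct.map_tmul, contract_tmul, contract_tmul, map_smul]
    rfl

variable [LeftModuleCoalgebra K H C]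

/-- This is the module algebra law `(x' y) l = ∑ (x' l₁)(y l₂)` for `x' = x S(k)`, with the two
actions on `x` merged into that of `S(k) l₁`. -/
theorem antipodeTwist₂_assoc_symm (x y : Dual K C) (t : H ⊗[K] H) :
    antipodeTwist₂ x y ((TensorProduct.assoc K H H H).symm
      ((Coalgebra.comul (R := K) (A := H)).lTensor H t)) = antipodeTwist x y t := by
  induction t with
  | zero => simp
  | add s t hs ht => simp only [map_add, hs, ht]
  | tmul k l =>
    rw [LinearMap.lTensor_tmul, antipodeTwist_tmul, mul_dualAct]
    generalize Coalgebra.comul (R := K) l = v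
    induction v with
    | zero => simp
    | add s t hs ht => simp only [TensorProduct.tmul_add, map_add, hs, ht]
    | tmul l m =>
      rw [TensorProduct.assoc_symm_tmul, antipodeTwist₂_tmul, LinearMap.rTensor_tmul,
        LinearMap.mul'_apply, dualAct_mul]
      rfl

/-- `x (y h) = ∑ ((x S(h₁)) y) h₂`. -/
theorem mul_dualAct_right (x y : Dual K C) (h : H) :
    x * dualAct y h = antipodeTwist x y (Coalgebra.comul (R := K) h) := by
  -- Coassociativity brings `h₁` and `h₂` together as `S(h₁) h₂`, and the counit then leaves `x (y
  -- h)`.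
  rw [← antipodeTwist₂_assoc_symm, Coalgebra.coassoc_symm_apply, antipodeTwist₂_rTensor_comul,
    Coalgebra.rTensor_counit_comul, TensorProduct.lid_tmul, one_smul]

/-- `Rat_C(C*)` is a right `H`-submodule of `C*`. -/
theorem dualAct_mem_ratC {y : Dual K C} (hy : y ∈ ratC K C (Dual K C)) (h : H) :
    dualAct y h ∈ ratC K C (Dual K C) := by
  obtain ⟨t, ht⟩ := (isRational_iff y).1 hy
  refine (isRational_iff _).2 ?_
  simp only [smul_eq_mul, mul_dualAct_right] at ht ⊢
  generalize Coalgebra.comul (R := K) h = w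
  induction w with
  | zero => exact ⟨0, by simp⟩
  | add s t hs ht =>
    obtain ⟨s', hs⟩ := hs
    obtain ⟨t', ht⟩ := ht
    exact ⟨s' + t', fun x => by rw [map_add, map_add, hs, ht]⟩
  | tmul k l =>
    -- If `x y = ∑ x(cᵢ) yᵢ` for all `x`, then `((x S(k)) y) l = ∑ x(S(k) cᵢ) (yᵢ l)`.
    exact ⟨TensorProduct.map (dualAct.flip l) (act K H C (HopfAlgebra.antipode K k)) t,
      fun x => by rw [contract_dualAct, ← ht, antipodeTwist_tmul]⟩

/-! ### The identification of `𝔞` with `A ⊗ Rat_C(C*)` -/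

variable [RightComoduleAlgebra K H A]

theorem tensorRat_tmul (a : A) (y : (ratC K C (Dual K C)).restrictScalars K) :
    tensorRat K H A C (a ⊗ₜ[K] y) = Smash.mk K H a y.1 := rfl

/-- Flatness of `A` preserves the injectivity of `Rat_C(C*) ⊆ C*`. It enters the proof only here. -/
theorem tensorRat_injective (hA : Module.Flat K A) : Function.Injective (tensorRat K H A C) :=
  (Smash.equiv K H A C).injective.comp
    (Module.Flat.lTensor_preserves_injective_linearMap _ (Submodule.injective_subtype _))

/-- In `(a ♯ e)(b ♯ z) = ∑ a b₀ ♯ (e b₁) z` the second factors stay in `Rat_C(C*)`, which is closed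
under `H` and under right multiplication by `C*`. -/
theorem mk_mul_mem_range_tensorRat {e : Dual K C} (he : e ∈ ratC K C (Dual K C))
    (a : A) (u : Smash K H A C) :
    Smash.mk K H a e * u ∈ LinearMap.range (tensorRat K H A C) := by
  induction u using Smash.induction_on with
  | zero => rw [mul_zero]; exact zero_mem _
  | add s t hs ht => rw [mul_add]; exact add_mem hs ht
  | mk b z =>
    rw [Smash.mk_mul_mk]
    generalize Smash.coact K H b = w
    induction w with
    | zero => rw [map_zero]; exact zero_mem _
    | add s t hs ht => rw [map_add]; exact add_mem hs ht
    | tmul b h =>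
      exact ⟨(a * b) ⊗ₜ ⟨_, mul_mem_ratC (dualAct_mem_ratC he h) z⟩, rfl⟩

theorem exists_mk_smul_eq (hC : LocallyProjective K C) (hRat : RatExact K C)
    {M : ModuleCat.{u} (Smash K H A C)} {m : M} (hm : m ∈ ratS M) :
    ∃ e ∈ ratC K C (Dual K C), Smash.mk K H (1 : A) e • m = m :=
  exists_mem_ratC_smul_eq (M := M) hC hRat hm

/-- Restrict the rationality condition to `s = 1 ♯ x`: there `⟨a ⊗ c, 1 ♯ x⟩ = x(c) a`, so a term
with coefficient `n` contributes `(a n) ⊗ c`. -/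
theorem ratT_le_ratS (M : ModuleCat.{u} (Smash K H A C)) : ratT K H A C M ≤ ratS M := by
  rintro m ⟨n, z, m', hm⟩
  have key : ∀ (z : A ⊗[K] C) (n : M), ∃ t : M ⊗[K] C, ∀ x : Dual K C,
      Smash.inclA K H A C (pairing z (Smash.mk K H 1 x)) • n = contract M x t := by
    intro z n
    induction z with
    | zero => exact ⟨0, by simp⟩
    | add s t hs ht =>
      obtain ⟨s', hs⟩ := hs
      obtain ⟨t', ht⟩ := ht
      exact ⟨s' + t', fun x => by
        rw [map_add, LinearMap.add_apply, map_add, add_smul, hs, ht, map_add]⟩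
    | tmul a c =>
      refine ⟨(a • n) ⊗ₜ c, fun x => ?_⟩
      rw [pairing_apply, one_mul, contract_tmul, ← smash_smul_A, smul_assoc]
  choose t ht using fun i => key (z i) (m' i)
  refine (isRational_iff m).2 ⟨∑ i, t i, fun x => ?_⟩
  rw [smash_smul_dual, Smash.inclC_apply, hm, map_sum]
  exact Finset.sum_congr rfl fun i _ => ht i x

/-- `a ♯ y = (a ♯ ε)(1 ♯ y)`, and `𝔞` is a left ideal containing `1 ♯ y`. -/
theorem tensorRat_mem_ratIdeal (t : A ⊗[K] ((ratC K C (Dual K C)).restrictScalars K)) :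
    tensorRat K H A C t ∈ ratIdeal K H A C := by
  induction t with
  | zero => rw [map_zero]; exact zero_mem _
  | add s t hs ht => rw [map_add]; exact add_mem hs ht
  | tmul a y =>
    rw [tensorRat_tmul, ← mul_one a, ← Smash.mk_one_mul_mk]
    exact (ratIdeal K H A C).smul_mem _ (mk_one_mem_ratIdeal y.2)

/-- `𝔞 = A ⊗ Rat_C(C*)`. -/
theorem ratIdeal_eq_range (hC : LocallyProjective K C) (hRat : RatExact K C) :
    (ratIdeal K H A C).restrictScalars K = LinearMap.range (tensorRat K H A C) := by
  apply le_antisymm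
  · intro u hu
    -- A local unit gives `u = (1 ♯ e) u`, and every such product lies in the image of `A ⊗
    -- Rat_C(C*)`.
    obtain ⟨e, he, heu⟩ := exists_mk_smul_eq hC hRat
      (ratT_le_ratS (ModuleCat.of (Smash K H A C) (Smash K H A C)) hu)
    have h := mk_mul_mem_range_tensorRat he (1 : A) u
    have heu' : Smash.mk K H 1 e * u = u := heu
    rwa [heu'] at h
  · rintro _ ⟨t, rfl⟩
    exact tensorRat_mem_ratIdeal t

/-! ### Homomorphisms out of `𝔞` -/

/-- The elements `1 ♯ y` generate `𝔞` as a left ideal, so a linear map on `𝔞` is determined by its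
values there. -/
theorem hat_injective (hC : LocallyProjective K C) (hRat : RatExact K C)
    (M : ModuleCat.{u} (Smash K H A C)) : Function.Injective (hat M) := by
  intro f g hfg
  ext ⟨u, hu⟩
  obtain ⟨t, rfl⟩ := (ratIdeal_eq_range hC hRat).le hu
  induction t with
  | zero =>
    have key : (⟨tensorRat K H A C 0, hu⟩ : ratIdeal K H A C) = 0 := Subtype.ext (map_zero _)
    rw [key, map_zero, map_zero]
  | add s t hs ht =>
    have key : (⟨tensorRat K H A C (s + t), hu⟩ : ratIdeal K H A C) =
        ⟨_, tensorRat_mem_ratIdeal s⟩ + ⟨_, tensorRat_mem_ratIdeal t⟩ :=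
      Subtype.ext (map_add _ _ _)
    rw [key, map_add, map_add, hs, ht]
  | tmul a y =>
    have key : (⟨tensorRat K H A C (a ⊗ₜ y), hu⟩ : ratIdeal K H A C) =
        Smash.inclA K H A C a • ⟨_, mk_one_mem_ratIdeal y.2⟩ :=
      Subtype.ext (Smash.inclA_mul_inclC a y.1).symm
    rw [key, map_smul, map_smul]
    exact congrArg _ (LinearMap.congr_fun hfg y)

/-- The `K`-linear map `a ⊗ y ↦ a g(y)`. -/
def tensorLift {M : ModuleCat.{u} (Smash K H A C)} (g : ratC K C (Dual K C) →ₗ[Dual K C] M) :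
    A ⊗[K] ((ratC K C (Dual K C)).restrictScalars K) →ₗ[K] M :=
  TensorProduct.lift ((act K A M).compl₂ (g.restrictScalars K))

theorem tensorLift_tmul {M : ModuleCat.{u} (Smash K H A C)}
    (g : ratC K C (Dual K C) →ₗ[Dual K C] M) (a : A)
    (y : (ratC K C (Dual K C)).restrictScalars K) : tensorLift g (a ⊗ₜ y) = a • g y := rfl

/-- Linearity of `a ♯ y ↦ a g(y)` over `A ♯ C*`, phrased through a representative `t'` so that no `A
♯ C*`-action on `A ⊗ Rat_C(C*)` has to be constructed. -/
theorem exists_tensorLift_smul {M : ModuleCat.{u} (Smash K H A C)}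
    (g : ratC K C (Dual K C) →ₗ[Dual K C] M) (s : Smash K H A C)
    (t : A ⊗[K] ((ratC K C (Dual K C)).restrictScalars K)) :
    ∃ t', tensorRat K H A C t' = s * tensorRat K H A C t ∧ tensorLift g t' = s • tensorLift g t := by
  induction t with
  | zero => exact ⟨0, by simp⟩
  | add t₁ t₂ h₁ h₂ =>
    obtain ⟨t₁', h₁, h₁'⟩ := h₁
    obtain ⟨t₂', h₂, h₂'⟩ := h₂
    exact ⟨t₁' + t₂', by rw [map_add, map_add, mul_add, h₁, h₂],
      by rw [map_add, map_add, smul_add, h₁', h₂']⟩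
  | tmul a y =>
  induction s using Smash.induction_on with
  | zero => exact ⟨0, by simp⟩
  | add t₁ t₂ h₁ h₂ =>
    obtain ⟨t₁', h₁, h₁'⟩ := h₁
    obtain ⟨t₂', h₂, h₂'⟩ := h₂
    exact ⟨t₁' + t₂', by rw [map_add, add_mul, h₁, h₂], by rw [map_add, add_smul, h₁', h₂']⟩
  | mk b x =>
  rw [tensorRat_tmul, tensorLift_tmul, smash_smul_A, smul_smul, Smash.inclA_apply,
    Smash.mk_mul_mk, Smash.mk_mul_mk]
  generalize Smash.coact K H a = w
  induction w with
  | zero => exact ⟨0, by simp⟩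
  | add t₁ t₂ h₁ h₂ =>
    obtain ⟨t₁', h₁, h₁'⟩ := h₁
    obtain ⟨t₂', h₂, h₂'⟩ := h₂
    exact ⟨t₁' + t₂', by rw [map_add, map_add, h₁, h₂],
      by rw [map_add, map_add, add_smul, h₁', h₂']⟩
  | tmul a h =>
    -- One term of `(b ♯ x)(a ♯ y) = ∑ b a₀ ♯ (x a₁) y`; the `C*`-linearity of `g` moves `x h`
    -- through `g`.
    refine ⟨(b * a) ⊗ₜ (dualAct x h • (y : ratC K C (Dual K C))), rfl, ?_⟩
    rw [Smash.twist_tmul, mul_one, smash_mk_smul]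
    exact congrArg _ (g.map_smul (dualAct x h) y)

theorem hat_surjective (hC : LocallyProjective K C) (hA : Module.Flat K A) (hRat : RatExact K C)
    (M : ModuleCat.{u} (Smash K H A C)) : Function.Surjective (hat M) := by
  intro g
  have hinj := tensorRat_injective (H := H) (C := C) hA
  -- `p` chooses preimages pointwise; injectivity of `tensorRat` makes them unique, which is why `p`
  -- respects sums and why the composite is linear.
  choose p hp using fun u : ratIdeal K H A C => (ratIdeal_eq_range hC hRat).le u.2
  refine ⟨⟨⟨fun u => tensorLift g (p u), fun u v => ?_⟩, fun s u => ?_⟩, ?_⟩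
  · rw [← map_add]
    congr 1
    apply hinj
    rw [hp, map_add, hp, hp]
    rfl
  · obtain ⟨t', h, h'⟩ := exists_tensorLift_smul g s (p u)
    rw [RingHom.id_apply, ← h']
    change tensorLift g _ = _
    congr 1
    apply hinj
    rw [hp, h, hp]
    rfl
  · ext y
    change tensorLift g (p ⟨Smash.mk K H 1 y.1, mk_one_mem_ratIdeal y.2⟩) = _
    rw [← one_smul A (g y)]
    refine (congrArg (tensorLift g) (hinj ?_)).trans (tensorLift_tmul g 1 y)
    exact hp _

/-! ### The candidate unit and the action of `Rat_C(C*)` on `Hom_{C*}(Rat_C(C*), M)` -/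

/-- The `A ♯ C*`-linear map `u ↦ u m` from `𝔞` to `M`. -/
def idealSMul {M : ModuleCat.{u} (Smash K H A C)} (m : M) : ratIdeal K H A C →ₗ[Smash K H A C] M :=
  LinearMap.toSpanSingleton (Smash K H A C) M m ∘ₗ (ratIdeal K H A C).subtype

section Adjunction

variable (hb : ∀ M : ModuleCat.{u} (Smash K H A C), Function.Bijective (hat M))

/-- The natural map `M → Hom_{C*}(Rat_C(C*), M)`, `m ↦ (y ↦ y m)`. -/
def toHomRat (M : ModuleCat.{u} (Smash K H A C)) : M ⟶ (homRat hb).obj M :=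
  letI := homRatModule hb M
  ModuleCat.ofHom (X := M) (Y := (ratC K C (Dual K C) →ₗ[Dual K C] M))
    { toFun := fun m => hat M (idealSMul m)
      map_add' := fun m n => LinearMap.ext fun y => smul_add _ m n
      map_smul' := fun s m => by
        refine Eq.trans ?_ (homRat_smul_hat hb M s (idealSMul m)).symm
        exact congrArg (hat M) (LinearMap.ext fun u => smul_smul u.1 s m) }

/-- An element of `Hom_{C*}(Rat_C(C*), M)` as a linear map. -/
def homRatLin {M : ModuleCat.{u} (Smash K H A C)} (g : (homRat hb).obj M) :
    ratC K C (Dual K C) →ₗ[Dual K C] M := g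

/-- Writing `g = hat M f`, both sides are `f((1 ♯ y)(1 ♯ z))`: once by the definition of the action,
once by linearity of `f`. -/
theorem homRat_mk_one_smul {M : ModuleCat.{u} (Smash K H A C)} (g : (homRat hb).obj M)
    (z y : ratC K C (Dual K C)) : homRatLin hb (Smash.mk K H (1 : A) z.1 • g) y =
      Smash.mk K H (1 : A) y.1 • homRatLin hb g z := by
  obtain ⟨f, rfl⟩ := (hb M).2 g
  refine (LinearMap.congr_fun (homRat_smul_hat hb M (Smash.mk K H (1 : A) z.1) f) y).trans ?_
  exact f.map_smul (Smash.mk K H (1 : A) y.1) ⟨_, mk_one_mem_ratIdeal z.2⟩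

/-- `y g` is the map `z ↦ z g(y)`. -/
theorem mk_one_smul_homRat {M : ModuleCat.{u} (Smash K H A C)} (g : (homRat hb).obj M)
    (z : ratC K C (Dual K C)) : Smash.mk K H (1 : A) z.1 • g =
      toHomRat hb M (homRatLin hb g z) :=
  LinearMap.ext fun y => homRat_mk_one_smul hb g z y

variable (hC : LocallyProjective K C)

/-- The action rebuilt from the coaction of `Rat_C(M)` is the one inherited from `M`; this makes the
inclusion in `M` linear over `A ♯ C*`. -/
theorem ratDKObj_smashSMul (M : ModuleCat.{u} (Smash K H A C)) (s : Smash K H A C)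
    (m : ratObj M) : (ratDKObj M hC).smashSMul s m = s • m := by
  induction s using Smash.induction_on with
  | zero => rw [map_zero, zero_smul]; rfl
  | add s t hs ht =>
    rw [map_add, add_smul, ← hs, ← ht]
    rfl
  | mk a x =>
    rw [smash_mk_smul]
    exact congrArg (a • ·) (contract_ratCoact M hC x m)

/-- The inclusion of `Rat_C(M)`, as a Doi-Koppinen module, in `M`. -/
def ratDKIncl (M : ModuleCat.{u} (Smash K H A C)) :
    (dkToSmash K H A C).obj ((ratDK H A hC).obj M) ⟶ M :=
  letI := (ratDKObj M hC).smashModule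
  ModuleCat.ofHom (X := (ratDKObj M hC).carrier)
    { toFun := ratIncl M
      map_add' := map_add _
      map_smul' := fun s m => (congrArg (ratIncl M) (ratDKObj_smashSMul hC M s m)).trans
        ((ratIncl M).map_smul s m) }

theorem ratDKIncl_injective (M : ModuleCat.{u} (Smash K H A C)) :
    Function.Injective (ratDKIncl hC M) :=
  (ratS M).injective_subtype

theorem exists_ratDKIncl_eq {M : ModuleCat.{u} (Smash K H A C)} {m : M} (hm : m ∈ ratS M) :
    ∃ r, ratDKIncl hC M r = m := ⟨(⟨m, hm⟩ : ratS M), rfl⟩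

theorem ratDKIncl_mem {M : ModuleCat.{u} (Smash K H A C)}
    (r : (dkToSmash K H A C).obj ((ratDK H A hC).obj M)) : ratDKIncl hC M r ∈ ratS M :=
  Subtype.property (p := (· ∈ ratS M)) r

/-- The `A ♯ C*`-linear map `u ↦ u m` from `𝔞` to `Rat_C(M)`. -/
def idealSMulRat {M : ModuleCat.{u} (Smash K H A C)} (m : M) :
    ratIdeal K H A C →ₗ[Smash K H A C] (dkToSmash K H A C).obj ((ratDK H A hC).obj M) :=
  (LinearEquiv.ofInjective (ratDKIncl hC M).hom (ratDKIncl_injective hC M)).symm.toLinearMap ∘ₗ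
    (idealSMul m).codRestrict (LinearMap.range (ratDKIncl hC M).hom) fun u =>
      -- `u m` is the image of `u ∈ 𝔞` under the linear map `s ↦ s m`, hence rational for the
      -- pairing and so over `C*`.
      exists_ratDKIncl_eq hC
        (ratT_le_ratS M (ratT_map (LinearMap.toSpanSingleton (Smash K H A C) M m) u.2))

theorem ratDKIncl_idealSMulRat {M : ModuleCat.{u} (Smash K H A C)} (m : M)
    (u : ratIdeal K H A C) : ratDKIncl hC M (idealSMulRat hC m u) = u.1 • m :=
  congrArg Subtype.val ((LinearEquiv.ofInjective (ratDKIncl hC M).hom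
    (ratDKIncl_injective hC M)).apply_symm_apply _)

/-- The unit `M → Hom_{C*}(Rat_C(C*), Rat_C(M))`, `m ↦ (y ↦ y m)`, of the adjunction. -/
def toHomRatRat (M : ModuleCat.{u} (Smash K H A C)) :
    M ⟶ (ratDK H A hC ⋙ dkToSmash K H A C ⋙ homRat hb).obj M :=
  letI := homRatModule hb ((dkToSmash K H A C).obj ((ratDK H A hC).obj M))
  ModuleCat.ofHom (X := M) (Y := (ratC K C (Dual K C) →ₗ[Dual K C]
      (dkToSmash K H A C).obj ((ratDK H A hC).obj M)))
    { toFun := fun m => hat _ (idealSMulRat hC m)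
      map_add' := fun m n => by
        rw [← map_add]
        refine congrArg _ (LinearMap.ext fun u => ratDKIncl_injective hC M ?_)
        rw [ratDKIncl_idealSMulRat, LinearMap.add_apply, map_add, ratDKIncl_idealSMulRat,
          ratDKIncl_idealSMulRat, smul_add]
      map_smul' := fun s m => by
        refine Eq.trans ?_ (homRat_smul_hat hb _ s (idealSMulRat hC m)).symm
        refine congrArg _ (LinearMap.ext fun u => ratDKIncl_injective hC M ?_)
        refine (ratDKIncl_idealSMulRat hC _ u).trans ((smul_smul u.1 s m).trans ?_)
        exact (ratDKIncl_idealSMulRat hC m ⟨u.1 * s, ratIdeal_mul_mem u.2 s⟩).symm }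

theorem ratDKIncl_toHomRatRat {M : ModuleCat.{u} (Smash K H A C)} (m : M)
    (y : ratC K C (Dual K C)) : ratDKIncl hC M (homRatLin hb (toHomRatRat hb hC M m) y) =
      Smash.mk K H (1 : A) y.1 • m :=
  ratDKIncl_idealSMulRat hC m ⟨_, mk_one_mem_ratIdeal y.2⟩

theorem homRat_ext {M : ModuleCat.{u} (Smash K H A C)} {g g' : (homRat hb).obj M}
    (h : ∀ y, homRatLin hb g y = homRatLin hb g' y) : g = g' := LinearMap.ext h

theorem toHomRatRat_naturality {M M' : ModuleCat.{u} (Smash K H A C)} (φ : M ⟶ M') :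
    φ ≫ toHomRatRat hb hC M' =
      toHomRatRat hb hC M ≫ (ratDK H A hC ⋙ dkToSmash K H A C ⋙ homRat hb).map φ := by
  ext m
  refine homRat_ext hb fun y => ratDKIncl_injective hC M' ?_
  refine (ratDKIncl_toHomRatRat hb hC (φ m) y).trans ?_
  refine ((φ.hom.map_smul _ m).symm.trans ?_)
  exact congrArg φ (ratDKIncl_toHomRatRat hb hC m y).symm

/-! ### Doi-Koppinen modules inside left `A ♯ C*`-modules -/

/-- Each element of a Doi-Koppinen module is fixed by an element of `Rat_C(C*)`. -/
theorem DKModule.exists_mk_smul_eq (hC : LocallyProjective K C) (hRat : RatExact K C) (N : DKModule K H A C)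
    (n : (dkToSmash K H A C).obj N) :
    ∃ e ∈ ratC K C (Dual K C), Smash.mk K H (1 : A) e • n = n := by
  have hsmul : ∀ (x : Dual K C) (n : N.carrier),
      N.smashRingHom (Smash.inclC K H A C x) n = N.dualSMul x n := fun x n => one_smul A _
  let _ : Module (Dual K C) N.carrier :=
    Module.compHom N.carrier (N.smashRingHom.comp (Smash.inclC K H A C).toRingHom)
  have : IsScalarTower K (Dual K C) N.carrier := ⟨fun k x n => by
    refine (hsmul (k • x) n).trans ((?_ : _ = k • N.dualSMul x n).trans
      (congrArg (k • ·) (hsmul x n)).symm)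
    rw [dualSMul, contract_smul]
    rfl⟩
  -- The coaction itself supplies the coefficients that make every `n` rational.
  exact exists_mem_ratC_smul_eq (M := N.carrier) hC hRat
    ((isRational_iff (M := N.carrier) n).2 ⟨N.coact n, fun x => hsmul x n⟩)

/-- If `y n = 0` for all `y ∈ Rat_C(C*)`, a local unit `e` of `n` gives `n = e n = 0`. -/
theorem DKModule.toHomRat_injective (hC : LocallyProjective K C) (hRat : RatExact K C)
    (N : DKModule K H A C) :
    Function.Injective (toHomRat hb ((dkToSmash K H A C).obj N)) := by
  refine (injective_iff_map_eq_zero (toHomRat hb ((dkToSmash K H A C).obj N)).hom).2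
    fun n hn => ?_
  obtain ⟨e, he, hen⟩ := N.exists_mk_smul_eq hC hRat n
  exact hen.symm.trans (congrArg (fun g => homRatLin hb g ⟨e, he⟩) hn)

/-- The `A ♯ C*`-linear maps between Doi-Koppinen modules are their morphisms. -/
theorem dkToSmash_map_bijective (hC : LocallyProjective K C) (M N : DKModule K H A C) :
    Function.Bijective fun f : M ⟶ N => (dkToSmash K H A C).map f := by
  refine ⟨fun f g h => DKModule.Hom.ext (LinearMap.ext fun m => ?_), fun f => ?_⟩
  · exact congrArg (fun φ : (dkToSmash K H A C).obj M ⟶ (dkToSmash K H A C).obj N => φ m) h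
  have hA : ∀ (L : DKModule K H A C) (a : A) (l : L.carrier),
      L.smashSMul (Smash.mk K H a 1) l = a • l := fun L a l => by
    rw [DKModule.smashSMul_mk, DKModule.dualSMul_one]
  have hD : ∀ (L : DKModule K H A C) (x : Dual K C) (l : L.carrier),
      L.smashSMul (Smash.mk K H 1 x) l = L.dualSMul x l := fun L x l => one_smul A _
  have hf : ∀ (s : Smash K H A C) (m : M.carrier),
      f.hom (M.smashSMul s m) = N.smashSMul s (f.hom m) := fun s m => f.hom.map_smul s m
  let φ : M.carrier →ₗ[A] N.carrier :=
    { toFun := f.hom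
      map_add' := f.hom.map_add
      map_smul' := fun a m =>
        (congrArg f.hom (hA M a m).symm).trans ((hf _ m).trans (hA N a (f.hom m))) }
  -- Elements of `N ⊗ C` are separated by `C*`, so colinearity follows from `C*`-linearity.
  refine ⟨⟨φ, fun m => hC.ext fun x => ?_⟩, rfl⟩
  rw [contract_map]
  exact (hD N x (φ m)).symm.trans ((hf _ m).symm.trans (congrArg f.hom (hD M x m)))

/-! ### Transposition is bijective; the adjunction -/

/-- The transpose of a map `Rat_C(M) → N`. -/
def homRatTranspose {M N : ModuleCat.{u} (Smash K H A C)}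
    (φ : (dkToSmash K H A C).obj ((ratDK H A hC).obj M) ⟶ N) : M ⟶ (homRat hb).obj N :=
  toHomRatRat hb hC M ≫ (homRat hb).map φ

theorem toHomRatRat_ratDKIncl {M : ModuleCat.{u} (Smash K H A C)}
    (r : (dkToSmash K H A C).obj ((ratDK H A hC).obj M)) (y : ratC K C (Dual K C)) :
    homRatLin hb (toHomRatRat hb hC M (ratDKIncl hC M r)) y = Smash.mk K H (1 : A) y.1 • r :=
  ratDKIncl_injective hC M ((ratDKIncl_toHomRatRat hb hC _ y).trans
    ((ratDKIncl hC M).hom.map_smul _ r).symm)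

/-- On a rational `r` the transpose is `y ↦ φ(y r) = y φ(r)`, so `φ` can be recovered from it
whenever `toHomRat` is injective on the target. -/
theorem ratDKIncl_homRatTranspose {M N : ModuleCat.{u} (Smash K H A C)}
    (φ : (dkToSmash K H A C).obj ((ratDK H A hC).obj M) ⟶ N) :
    ratDKIncl hC M ≫ homRatTranspose hb hC φ = φ ≫ toHomRat hb N := by
  ext r
  refine homRat_ext hb fun y => ?_
  refine Eq.trans (b := φ (Smash.mk K H (1 : A) y.1 • r)) ?_ (φ.hom.map_smul _ r)
  exact congrArg φ (toHomRatRat_ratDKIncl hb hC r y)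

theorem homRatTranspose_injective (hRat : RatExact K C) (M : ModuleCat.{u} (Smash K H A C))
    (N : DKModule K H A C) : Function.Injective
      (homRatTranspose hb hC (M := M) (N := (dkToSmash K H A C).obj N)) := by
  intro φ φ' h
  have h' : φ ≫ toHomRat hb _ = φ' ≫ toHomRat hb _ := by
    rw [← ratDKIncl_homRatTranspose hb hC, h, ratDKIncl_homRatTranspose]
  ext r
  exact N.toHomRat_injective hb hC hRat
    (congrArg (fun χ : _ ⟶ (homRat hb).obj ((dkToSmash K H A C).obj N) => χ r) h')

theorem homRatTranspose_surjective (hRat : RatExact K C) (M : ModuleCat.{u} (Smash K H A C))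
    (N : DKModule K H A C) : Function.Surjective
      (homRatTranspose hb hC (M := M) (N := (dkToSmash K H A C).obj N)) := by
  intro ψ
  have hinj := N.toHomRat_injective hb hC hRat
  have hr : ∀ r, ψ (ratDKIncl hC M r) ∈
      LinearMap.range (toHomRat hb ((dkToSmash K H A C).obj N)).hom := by
    intro r
    obtain ⟨e, he, h⟩ := exists_mk_smul_eq hC hRat (ratDKIncl_mem hC r)
    -- With `e r = r`, linearity gives `ψ(r) = e ψ(r)`, which is the image of `n = ψ(r)(e)`.
    refine ⟨homRatLin hb (ψ (ratDKIncl hC M r)) ⟨e, he⟩, ?_⟩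
    refine (mk_one_smul_homRat hb (ψ (ratDKIncl hC M r)) ⟨e, he⟩).symm.trans ?_
    exact (ψ.hom.map_smul _ _).symm.trans (congrArg ψ h)
  let φ : (dkToSmash K H A C).obj ((ratDK H A hC).obj M) ⟶ (dkToSmash K H A C).obj N :=
    ModuleCat.ofHom (X := (dkToSmash K H A C).obj ((ratDK H A hC).obj M))
      (Y := (dkToSmash K H A C).obj N) ((LinearEquiv.ofInjective (toHomRat hb _).hom hinj).symm.toLinearMap ∘ₗ
      (ψ.hom ∘ₗ (ratDKIncl hC M).hom).codRestrict _ hr)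
  have hφ : ∀ r, toHomRat hb _ (φ r) = ψ (ratDKIncl hC M r) := fun r =>
    congrArg Subtype.val ((LinearEquiv.ofInjective (toHomRat hb _).hom hinj).apply_symm_apply _)
  refine ⟨φ, ?_⟩
  ext m
  -- For arbitrary `m` the element `y m` is rational, and both `φ(y m)` and `ψ(m)(y)` have image
  -- `ψ(y m) = y ψ(m)` under `toHomRat`.
  refine homRat_ext hb fun y => hinj ?_
  refine (hφ (homRatLin hb (toHomRatRat hb hC M m) y)).trans ?_
  refine (congrArg ψ (ratDKIncl_toHomRatRat hb hC m y)).trans ?_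
  exact (ψ.hom.map_smul _ m).trans (mk_one_smul_homRat hb (ψ m) y)

/-- `Hom_{C*}(Rat_C(C*), -)` is right adjoint to `Rat_C`. -/
def ratAdjunction (hRat : RatExact K C) : ratDK H A hC ⊣ dkToSmash K H A C ⋙ homRat hb :=
  have hbij : ∀ (M : ModuleCat.{u} (Smash K H A C)) (N : DKModule K H A C),
      Function.Bijective fun f : (ratDK H A hC).obj M ⟶ N =>
        homRatTranspose hb hC ((dkToSmash K H A C).map f) := fun M N =>
    Function.Bijective.comp (g := homRatTranspose hb hC)
      ⟨homRatTranspose_injective hb hC hRat M N, homRatTranspose_surjective hb hC hRat M N⟩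
      (dkToSmash_map_bijective hC _ _)
  Adjunction.mkOfHomEquiv
    { homEquiv := fun M N => Equiv.ofBijective _ (hbij M N)
      homEquiv_naturality_left_symm := fun {M M' N} f g => by
        -- Naturality of the inverse is checked on transposes, where it reduces to naturality of the
        -- unit in `M`.
        rw [Equiv.symm_apply_eq]
        obtain ⟨g, rfl⟩ := (Equiv.ofBijective _ (hbij M' N)).surjective g
        rw [Equiv.symm_apply_apply]
        exact congrArg (· ≫ (homRat hb).map ((dkToSmash K H A C).map g))
          (toHomRatRat_naturality hb hC f)
      homEquiv_naturality_right := fun f g => rfl }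

end Adjunction

end DoiKoppinen

end

theorem mainTheorem5 (K H A C : Type u) [CommRing K] [Ring H] [HopfAlgebra K H]
    [Ring A] [Algebra K A] [DoiKoppinen.RightComoduleAlgebra K H A]
    [AddCommGroup C] [Module K C] [Coalgebra K C] [Module H C] [IsScalarTower K H C]
    [DoiKoppinen.LeftModuleCoalgebra K H C]
    (hC : DoiKoppinen.LocallyProjective K C) (hA : Module.Flat K A)
    (hRat : DoiKoppinen.RatExact K C) :
    ((∀ y ∈ DoiKoppinen.ratC K C (DoiKoppinen.Dual K C), ∀ h : H,
        DoiKoppinen.dualAct y h ∈ DoiKoppinen.ratC K C (DoiKoppinen.Dual K C)) ∧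
      Function.Injective (DoiKoppinen.tensorRat K H A C) ∧
      (DoiKoppinen.ratIdeal K H A C).restrictScalars K =
        LinearMap.range (DoiKoppinen.tensorRat K H A C)) ∧
    ∃ hb : ∀ M : ModuleCat.{u} (DoiKoppinen.Smash K H A C),
        Function.Bijective (DoiKoppinen.hat M),
      Nonempty (DoiKoppinen.ratDK H A hC ⊣
        DoiKoppinen.dkToSmash K H A C ⋙ DoiKoppinen.homRat hb) :=
  ⟨⟨fun _ hy h => DoiKoppinen.dualAct_mem_ratC hy h, DoiKoppinen.tensorRat_injective hA,
    DoiKoppinen.ratIdeal_eq_range hC hRat⟩,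
    fun M => ⟨DoiKoppinen.hat_injective hC hRat M, DoiKoppinen.hat_surjective hC hA hRat M⟩,
    ⟨DoiKoppinen.ratAdjunction _ hC hRat⟩⟩
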